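/- **Setting.** Let $(E_n,\mathcal B_n,\mu_n)$, $n\in\mathbb N$, be probability spaces with product $(E,\mathcal B,\mu)$, and let $\mathbb X=(X_n)_{n}$ and $\mathbb X'=(X_n')_{n}$ be independent $E$-valued random sequences on a probability space $(\Omega,\mathcal A,\mathbb P)$, each with distribution $\mu$. For $k\in\mathbb N$ let $\mathbb X^{(k)}$ be $\mathbb X$ with its $k$-th coordinate replaced by $X_k'$, and let $\mathcal G_k=\sigma(X_j,\,j\neq k)$. Let $L^2_{\mathbb X}=L^2(\Omega,\sigma(\mathbb X),\mathbb P)$. A representative of $F\in L^2_{\mathbb X}$ is a function $f\in L^2(\mu)$ with $F=f(\mathbb X)$ a.s. Put $D_kF=F-\mathbb E[F\mid\mathcal G_k]$. Let $\mathcal S$ be the set of those $F\in L^2_{\mathbb X}$ that are $\sigma(X_j,\,j\in J)$-measurable for some finite $J\subset\mathbb N$. The Malliavin derivative $D:\operatorname{dom}(D)\subseteq L^2_{\mathbb X}\to L^2(\kappa\otimes\mathbb P|_{\sigma(\mathbb X)})$, with $\kappa$ the counting measure on $\mathbb N$, is the closure of the operator $F\mapsto(D_kF)_{k}$ on $\mathcal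 S$; $\delta$ is the adjoint of $D$; and $L=-\delta D$ with $\operatorname{dom}(L)=\{F\in\operatorname{dom}(D):DF\in\operatorname{dom}(\delta)\}$. For $F\in L^2_{\mathbb X}$ with $\mathbb E[F]=0$, $L^{-1}F$ denotes the a.s. unique centered $G\in\operatorname{dom}(L)$ with $LG=F$. For $F,G\in\operatorname{dom}(D)$ with representatives $f,g$ put $$\Gamma_0(F,G)=\frac12\sum_{k}\mathbb E\Bigl[\bigl(f(\mathbb X^{(k)})-f(\mathbb X)\bigr)\bigl(g(\mathbb X^{(k)})-g(\mathbb X)\bigr)\,\Big|\,\mathbb X\Bigr].$$ For integrable real random variables $Y,W$ let $$d_{\mathcal W}(Y,W)=\sup_{h}\bigl|\mathbb E[h(Y)]-\mathbb E[h(W)]\bigr|,\qquad d_{\mathcal K}(Y,W)=\sup_{z\in\mathbb R}\bigl|\mathbb P(Y\le z)-\mathbb P(W\le z)\bigr|,$$ where the first supremum runs over all $h:\mathbb R\to\mathbb R$ that are Lipschitz with constant $1$. Let $Z\sim N(0,1)$. **Theorem (carré-du-champ bounds).** Let $F\in\operatorname{dom}(D)$ with $\mathbb E[F]=0$, and let $f,g\in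 L^2(\mu)$ be representatives of $F$ and $L^{-1}F$, respectively. Then the series defining $\Gamma_0(F,-L^{-1}F)$ and the series $\sum_k|g(\mathbb X^{(k)})-g(\mathbb X)|\,(f(\mathbb X^{(k)})-f(\mathbb X))$ converge a.s. to integrable random variables, and $$d_{\mathcal W}(F,Z)\le\sqrt{\frac2\pi}\;\mathbb E\bigl|1-\Gamma_0(F,-L^{-1}F)\bigr|+\frac12\sum_{k}\mathbb E\Bigl[\bigl|g(\mathbb X^{(k)})-g(\mathbb X)\bigr|\bigl(f(\mathbb X^{(k)})-f(\mathbb X)\bigr)^2\Bigr],$$ $$d_{\mathcal K}(F,Z)\le\mathbb E\bigl|1-\Gamma_0(F,-L^{-1}F)\bigr|+\mathbb E\,\biggl|\,\mathbb E\Bigl[\sum_{k}\bigl|g(\mathbb X^{(k)})-g(\mathbb X)\bigr|\bigl(f(\mathbb X^{(k)})-f(\mathbb X)\bigr)\,\Big|\,F\Bigr]\biggr|,$$ where the last sum in the first bound may be $+\infty$. -/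

import Mathlib

open MeasureTheory ProbabilityTheory Filter Topology
open scoped ENNReal

/-! ### Setting: functionals of a sequence `X` of independent coordinates -/

section Setting

variable {Ω : Type*} [MeasurableSpace Ω] {E : ℕ → Type*} [∀ n, MeasurableSpace (E n)]

/-- The `σ`-field `σ(X_j, j ∈ M)` generated by the coordinates of `X` with index in `M`. -/
def sigmaCoord (X : Ω → ∀ n, E n) (M : Set ℕ) : MeasurableSpace Ω :=
  ⨆ j ∈ M, MeasurableSpace.comap (fun ω => X ω j) inferInstance

/-- `X^{(k)}`: the sequence `X` with its `k`-th coordinate replaced by that of `X'`. -/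
def resample (X X' : Ω → ∀ n, E n) (k : ℕ) (ω : Ω) : ∀ n, E n :=
  Function.update (X ω) k (X' ω k)

/-- `F ∈ L²_X`: `F` is a square-integrable `σ(X)`-measurable real random variable. -/
structure MemL2X (P : Measure Ω) (X : Ω → ∀ n, E n) (F : Ω → ℝ) : Prop where
  measurable : Measurable[sigmaCoord X Set.univ] F
  memLp : MemLp F 2 P

/-- `F ∈ 𝒮`: `F ∈ L²_X` is cylindrical, i.e. depends on finitely many coordinates only. -/
structure IsCylindrical (P : Measure Ω) (X : Ω → ∀ n, E n) (F : Ω → ℝ) : Prop where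
  measurable : ∃ n : ℕ, Measurable[sigmaCoord X (Set.Iio n)] F
  memLp : MemLp F 2 P

/-- `U ∈ L²(κ ⊗ P_𝓕)`: a process `U = (U_k)` of `σ(X)`-measurable random variables with
`∑ₖ E[U_k²] < ∞` (`κ` is counting measure). -/
structure MemL2Process (P : Measure Ω) (X : Ω → ∀ n, E n) (U : ℕ → Ω → ℝ) : Prop where
  measurable : ∀ k, Measurable[sigmaCoord X Set.univ] (U k)
  sq_summable : ∑' k, ∫⁻ ω, ‖U k ω‖ₑ ^ 2 ∂P < ∞

/-- `f ∈ L²(μ)` is a representative of the random variable `F`: `F = f ∘ X` almost surely. -/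
structure IsRepresentative (P : Measure Ω) (X : Ω → ∀ n, E n) (μ : Measure (∀ n, E n))
    (F : Ω → ℝ) (f : (∀ n, E n) → ℝ) : Prop where
  measurable : Measurable f
  memLp : MemLp f 2 μ
  ae_eq : F =ᵐ[P] fun ω => f (X ω)

/-! ### The Malliavin operators -/

/-- `D_k F = F - E[F | 𝓖_k]`, where `𝓖_k = σ(X_j, j ≠ k)`. -/
noncomputable def gradCoord (P : Measure Ω) (X : Ω → ∀ n, E n) (k : ℕ) (F : Ω → ℝ) : Ω → ℝ :=
  fun ω => F ω - (P[F | sigmaCoord X {k}ᶜ]) ω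

/-- `F ∈ dom(D)` and `DF = V`: the pair `(F, V)` lies in the closure, in
`L²_X × L²(κ ⊗ P_𝓕)`, of the graph of `F ↦ (D_k F)_k` on the cylindrical random variables. -/
structure IsMalliavinDeriv (P : Measure Ω) (X : Ω → ∀ n, E n) (F : Ω → ℝ)
    (V : ℕ → Ω → ℝ) : Prop where
  memL2X : MemL2X P X F
  memL2Process : MemL2Process P X V
  exists_approx : ∃ S : ℕ → Ω → ℝ, (∀ n, IsCylindrical P X (S n)) ∧
    Tendsto (fun n => ∫⁻ ω, ‖S n ω - F ω‖ₑ ^ 2 ∂P) atTop (𝓝 0) ∧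
    Tendsto (fun n => ∑' k, ∫⁻ ω, ‖gradCoord P X k (S n) ω - V k ω‖ₑ ^ 2 ∂P) atTop (𝓝 0)

/-- `F ∈ dom(D)`. -/
def MemDomD (P : Measure Ω) (X : Ω → ∀ n, E n) (F : Ω → ℝ) : Prop :=
  ∃ V : ℕ → Ω → ℝ, IsMalliavinDeriv P X F V

/-- `U ∈ dom(δ)` and `δU = H`, where `δ` is the Hilbert space adjoint of `D`:
`⟨DF, U⟩ = E[F H]` for all `F ∈ dom(D)`. -/
structure IsDivergence (P : Measure Ω) (X : Ω → ∀ n, E n) (U : ℕ → Ω → ℝ)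
    (H : Ω → ℝ) : Prop where
  memL2Process : MemL2Process P X U
  memL2X : MemL2X P X H
  adjoint : ∀ (F : Ω → ℝ) (V : ℕ → Ω → ℝ), IsMalliavinDeriv P X F V →
    ∑' k, ∫ ω, V k ω * U k ω ∂P = ∫ ω, F ω * H ω ∂P

/-- `G ∈ dom(L)` and `LG = H`, where `L = -δD` is the Ornstein-Uhlenbeck generator. -/
def IsOUGenerator (P : Measure Ω) (X : Ω → ∀ n, E n) (G H : Ω → ℝ) : Prop :=
  ∃ V : ℕ → Ω → ℝ, IsMalliavinDeriv P X G V ∧ IsDivergence P X V (fun ω => - H ω)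

/-- `G` is centered, `G ∈ dom(L)` and `LG = F`. For centered `F ∈ L²_X` this determines `G`
almost surely. -/
def IsOUPreimage (P : Measure Ω) (X : Ω → ∀ n, E n) (F G : Ω → ℝ) : Prop :=
  IsOUGenerator P X G F ∧ ∫ ω, G ω ∂P = 0

open Classical in
/-- The pseudo-inverse `L⁻¹F`: the (almost surely unique) centered `G ∈ dom(L)` with `LG = F`
(and `0` if there is none, which does not happen for centered `F ∈ L²_X`). -/
noncomputable def ouPseudoInverse (P : Measure Ω) (X : Ω → ∀ n, E n) (F : Ω → ℝ) : Ω → ℝ :=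
  if h : ∃ G : Ω → ℝ, IsOUPreimage P X F G then h.choose else 0

/-! ### The carré-du-champ operator -/

/-- `E[(f(X^{(k)}) - f(X)) (g(X^{(k)}) - g(X)) | X]`. -/
noncomputable def carreDuChampTerm (P : Measure Ω) (X X' : Ω → ∀ n, E n)
    (f g : (∀ n, E n) → ℝ) (k : ℕ) : Ω → ℝ :=
  P[fun ω => (f (resample X X' k ω) - f (X ω)) * (g (resample X X' k ω) - g (X ω))
    | sigmaCoord X Set.univ]

/-- `Γ₀(F, G)`, where `f` and `g` are representatives of `F` and `G`. -/
noncomputable def carreDuChamp (P : Measure Ω) (X X' : Ω → ∀ n, E n)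
    (f g : (∀ n, E n) → ℝ) : Ω → ℝ :=
  fun ω => (1 / 2) * ∑' k, carreDuChampTerm P X X' f g k ω

end Setting

/-! ### Distances between distributions on the real line -/

/-- The Wasserstein distance between two laws on `ℝ`. -/
noncomputable def wassersteinDist (ν₁ ν₂ : Measure ℝ) : ℝ≥0∞ :=
  ⨆ (h : ℝ → ℝ) (_ : LipschitzWith 1 h), ENNReal.ofReal |∫ x, h x ∂ν₁ - ∫ x, h x ∂ν₂|

/-- The Kolmogorov distance between two laws on `ℝ`. -/
noncomputable def kolmogorovDist (ν₁ ν₂ : Measure ℝ) : ℝ≥0∞ :=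
  ⨆ z : ℝ, ENNReal.ofReal |ν₁.real (Set.Iic z) - ν₂.real (Set.Iic z)|

/-! ### The standard Gaussian density and distribution function -/

/-- The density of the standard Gaussian distribution. -/
noncomputable def stdPdf (x : ℝ) : ℝ := gaussianPDFReal 0 1 x

/-- The distribution function of the standard Gaussian distribution. -/
noncomputable def stdCdf (x : ℝ) : ℝ := (gaussianReal 0 1).real (Set.Iic x)

lemma stdPdf_eq (x : ℝ) : stdPdf x = (Real.sqrt (2 * Real.pi))⁻¹ * Real.exp (-x ^ 2 / 2) := by
  simp [stdPdf, gaussianPDFReal]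

lemma stdPdf_pos (x : ℝ) : 0 < stdPdf x := gaussianPDFReal_pos _ _ _ one_ne_zero

lemma stdPdf_neg (x : ℝ) : stdPdf (-x) = stdPdf x := by simp [stdPdf_eq]

lemma stdPdf_le_zero (x : ℝ) : stdPdf x ≤ stdPdf 0 := by
  rw [stdPdf_eq, stdPdf_eq]
  refine mul_le_mul_of_nonneg_left (Real.exp_le_exp.2 ?_) (by positivity)
  nlinarith [sq_nonneg x]

lemma two_mul_stdPdf_zero : 2 * stdPdf 0 = Real.sqrt (2 / Real.pi) := by
  have h2 : Real.sqrt 2 ^ 2 = 2 := Real.sq_sqrt (by norm_num)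
  have hpi : 0 < Real.sqrt Real.pi := Real.sqrt_pos.2 Real.pi_pos
  rw [stdPdf_eq, Real.sqrt_div (by norm_num), Real.sqrt_mul (by norm_num)]
  field_simp
  simp [h2]

lemma stdPdf_zero_le_one : stdPdf 0 ≤ 1 := by
  have : Real.sqrt (2 / Real.pi) ≤ 1 := by
    rw [Real.sqrt_le_one, div_le_one Real.pi_pos]
    linarith [Real.pi_gt_three]
  linarith [two_mul_stdPdf_zero, stdPdf_pos 0]

lemma hasDerivAt_stdPdf (x : ℝ) : HasDerivAt stdPdf (-x * stdPdf x) x := by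
  have h1 : HasDerivAt (fun y : ℝ => -y ^ 2 / 2) (-x) x :=
    (((hasDerivAt_pow 2 x).neg).div_const 2).congr_deriv (by norm_num; ring)
  have h := (h1.exp).const_mul (Real.sqrt (2 * Real.pi))⁻¹
  have e : stdPdf = fun y => (Real.sqrt (2 * Real.pi))⁻¹ * Real.exp (-y ^ 2 / 2) :=
    funext stdPdf_eq
  rw [e]
  exact h.congr_deriv (by ring)

lemma continuous_stdPdf : Continuous stdPdf :=
  continuous_iff_continuousAt.2 fun x => (hasDerivAt_stdPdf x).continuousAt

lemma integrable_stdPdf : Integrable stdPdf := integrable_gaussianPDFReal 0 1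

lemma integrable_id_mul_stdPdf : Integrable fun x => x * stdPdf x := by
  have := (integrable_mul_exp_neg_mul_sq (b := 1 / 2) (by norm_num)).const_mul
    (Real.sqrt (2 * Real.pi))⁻¹
  refine this.congr (ae_of_all _ fun x => ?_)
  simp only [stdPdf_eq]
  rw [show -x ^ 2 / 2 = -(1 / 2) * x ^ 2 by ring]
  ring

lemma integrable_sq_mul_stdPdf : Integrable fun x => x ^ 2 * stdPdf x := by
  have := (integrable_rpow_mul_exp_neg_mul_sq (b := 1 / 2) (by norm_num)
    (s := 2) (by norm_num)).const_mul (Real.sqrt (2 * Real.pi))⁻¹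
  refine this.congr (ae_of_all _ fun x => ?_)
  simp only [stdPdf_eq, Real.rpow_two]
  rw [show -x ^ 2 / 2 = -(1 / 2) * x ^ 2 by ring]
  ring

lemma hasDerivAt_id_mul_stdPdf (x : ℝ) :
    HasDerivAt (fun y => y * stdPdf y) (stdPdf x - x ^ 2 * stdPdf x) x :=
  ((hasDerivAt_id x).mul (hasDerivAt_stdPdf x)).congr_deriv (by simp; ring)

lemma integral_gaussianReal_eq (h : ℝ → ℝ) :
    ∫ x, h x ∂gaussianReal 0 1 = ∫ x, h x * stdPdf x := by
  rw [integral_gaussianReal_eq_integral_smul one_ne_zero]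
  simp [stdPdf, mul_comm]

lemma stdCdf_eq_integral (x : ℝ) : stdCdf x = ∫ t in Set.Iic x, stdPdf t := by
  rw [stdCdf, measureReal_def, gaussianReal_apply_eq_integral _ one_ne_zero, ENNReal.toReal_ofReal]
  · rfl
  · exact integral_nonneg fun t => (stdPdf_pos t).le

lemma integral_stdPdf : ∫ t, stdPdf t = 1 := integral_gaussianPDFReal_eq_one 0 one_ne_zero

lemma integral_Ioi_eq_sub_integral_Iic {g : ℝ → ℝ} (hg : Integrable g) (x : ℝ) :
    ∫ t in Set.Ioi x, g t = (∫ t, g t) - ∫ t in Set.Iic x, g t := by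
  rw [← integral_add_compl (measurableSet_Iic (a := x)) hg, Set.compl_Iic]
  ring

lemma integral_Ioi_stdPdf (x : ℝ) : ∫ t in Set.Ioi x, stdPdf t = 1 - stdCdf x := by
  rw [integral_Ioi_eq_sub_integral_Iic integrable_stdPdf, integral_stdPdf, stdCdf_eq_integral]

lemma stdCdf_nonneg (x : ℝ) : 0 ≤ stdCdf x := measureReal_nonneg

lemma stdCdf_le_one (x : ℝ) : stdCdf x ≤ 1 := measureReal_le_one

lemma hasDerivAt_integral_Iic {g : ℝ → ℝ} (hg : Integrable g) (hc : Continuous g) (x : ℝ) :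
    HasDerivAt (fun y => ∫ t in Set.Iic y, g t) (g x) x := by
  have h : HasDerivAt (fun y => (∫ t in Set.Iic x, g t) + ∫ t in x..y, g t) (g x) x := by
    refine HasDerivAt.const_add _ ?_
    exact intervalIntegral.integral_hasDerivAt_right (hc.intervalIntegrable _ _)
      hc.stronglyMeasurable.stronglyMeasurableAtFilter hc.continuousAt
  refine h.congr_of_eventuallyEq (Eventually.of_forall fun y => ?_)
  have := intervalIntegral.integral_Iic_sub_Iic (μ := volume) (f := g) (a := x) (b := y)
    hg.integrableOn hg.integrableOn
  simp only
  linarith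

lemma hasDerivAt_stdCdf (x : ℝ) : HasDerivAt stdCdf (stdPdf x) x := by
  rw [show stdCdf = fun y => ∫ t in Set.Iic y, stdPdf t from funext stdCdf_eq_integral]
  exact hasDerivAt_integral_Iic integrable_stdPdf continuous_stdPdf x

lemma continuous_stdCdf : Continuous stdCdf :=
  continuous_iff_continuousAt.2 fun x => (hasDerivAt_stdCdf x).continuousAt

lemma integrable_neg_id_mul_stdPdf : Integrable fun x => -x * stdPdf x := by
  simpa using integrable_id_mul_stdPdf.neg

lemma tendsto_stdPdf_atTop : Tendsto stdPdf atTop (𝓝 0) :=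
  tendsto_zero_of_hasDerivAt_of_integrableOn_Ioi (a := 0) (fun x _ => hasDerivAt_stdPdf x)
    integrable_neg_id_mul_stdPdf.integrableOn integrable_stdPdf.integrableOn

lemma tendsto_stdPdf_atBot : Tendsto stdPdf atBot (𝓝 0) :=
  tendsto_zero_of_hasDerivAt_of_integrableOn_Iic (a := 0) (fun x _ => hasDerivAt_stdPdf x)
    integrable_neg_id_mul_stdPdf.integrableOn integrable_stdPdf.integrableOn

lemma integrable_deriv_id_mul_stdPdf : Integrable fun x => stdPdf x - x ^ 2 * stdPdf x :=
  integrable_stdPdf.sub integrable_sq_mul_stdPdf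

lemma tendsto_id_mul_stdPdf_atTop : Tendsto (fun x => x * stdPdf x) atTop (𝓝 0) :=
  tendsto_zero_of_hasDerivAt_of_integrableOn_Ioi (a := 0) (fun x _ => hasDerivAt_id_mul_stdPdf x)
    integrable_deriv_id_mul_stdPdf.integrableOn integrable_id_mul_stdPdf.integrableOn

lemma integral_Iic_id_mul_stdPdf (x : ℝ) : ∫ t in Set.Iic x, t * stdPdf t = -stdPdf x := by
  have := integral_Iic_of_hasDerivAt_of_tendsto' (a := x) (fun y _ => hasDerivAt_stdPdf y)
    integrable_neg_id_mul_stdPdf.integrableOn tendsto_stdPdf_atBot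
  simp only [neg_mul, integral_neg, sub_zero] at this
  linarith

lemma integral_Ioi_id_mul_stdPdf (x : ℝ) : ∫ t in Set.Ioi x, t * stdPdf t = stdPdf x := by
  have := integral_Ioi_of_hasDerivAt_of_tendsto' (a := x) (fun y _ => hasDerivAt_stdPdf y)
    integrable_neg_id_mul_stdPdf.integrableOn tendsto_stdPdf_atTop
  simp only [neg_mul, integral_neg] at this
  linarith

lemma integral_Ioi_sq_mul_stdPdf (x : ℝ) :
    ∫ t in Set.Ioi x, t ^ 2 * stdPdf t = x * stdPdf x + (1 - stdCdf x) := by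
  have := integral_Ioi_of_hasDerivAt_of_tendsto' (a := x) (fun y _ => hasDerivAt_id_mul_stdPdf y)
    integrable_deriv_id_mul_stdPdf.integrableOn tendsto_id_mul_stdPdf_atTop
  rw [integral_sub integrable_stdPdf.integrableOn integrable_sq_mul_stdPdf.integrableOn,
    integral_Ioi_stdPdf] at this
  linarith

lemma stdCdf_neg (x : ℝ) : stdCdf (-x) = 1 - stdCdf x := by
  rw [stdCdf_eq_integral, ← integral_Ioi_stdPdf]
  simpa [stdPdf_neg] using integral_comp_neg_Iic (-x) stdPdf

lemma integral_Iic_sub_mul_stdPdf (x : ℝ) :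
    ∫ t in Set.Iic x, (x - t) * stdPdf t = stdPdf x + x * stdCdf x := by
  simp only [sub_mul]
  rw [integral_sub (integrable_stdPdf.const_mul x).integrableOn
    integrable_id_mul_stdPdf.integrableOn, integral_const_mul, integral_Iic_id_mul_stdPdf,
    ← stdCdf_eq_integral]
  ring

lemma integral_Ioi_sub_mul_stdPdf (x : ℝ) :
    ∫ t in Set.Ioi x, (t - x) * stdPdf t = stdPdf x - x * (1 - stdCdf x) := by
  simp only [sub_mul]
  rw [integral_sub integrable_id_mul_stdPdf.integrableOn
    (integrable_stdPdf.const_mul x).integrableOn, integral_const_mul, integral_Ioi_id_mul_stdPdf,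
    integral_Ioi_stdPdf]

/-! ### Mills ratio inequalities -/

lemma id_mul_one_sub_stdCdf_le (x : ℝ) : x * (1 - stdCdf x) ≤ stdPdf x := by
  have := setIntegral_nonneg (μ := volume) (f := fun t => (t - x) * stdPdf t)
    (measurableSet_Ioi (a := x)) fun t (ht : x < t) =>
      mul_nonneg (sub_nonneg.2 ht.le) (stdPdf_pos t).le
  rw [integral_Ioi_sub_mul_stdPdf] at this
  linarith

lemma neg_stdPdf_le_id_mul_stdCdf (x : ℝ) : -stdPdf x ≤ x * stdCdf x := by
  have := id_mul_one_sub_stdCdf_le (-x)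
  rw [stdCdf_neg, stdPdf_neg] at this
  linarith

lemma id_mul_stdPdf_le (x : ℝ) : x * stdPdf x ≤ (1 + x ^ 2) * (1 - stdCdf x) := by
  have h := setIntegral_nonneg (μ := volume) (f := fun t => (t - x) ^ 2 * stdPdf t)
    (measurableSet_Ioi (a := x)) fun t _ => mul_nonneg (sq_nonneg _) (stdPdf_pos t).le
  have e : ∀ t, (t - x) ^ 2 * stdPdf t
      = t ^ 2 * stdPdf t - (2 * x) * (t * stdPdf t) + x ^ 2 * stdPdf t := fun t => by ring
  simp only [e] at h
  have hi : Integrable fun t => t ^ 2 * stdPdf t - (2 * x) * (t * stdPdf t) :=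
    integrable_sq_mul_stdPdf.sub (integrable_id_mul_stdPdf.const_mul _)
  rw [integral_add hi.integrableOn (integrable_stdPdf.const_mul _).integrableOn,
    integral_sub integrable_sq_mul_stdPdf.integrableOn
      (integrable_id_mul_stdPdf.const_mul _).integrableOn,
    integral_const_mul, integral_const_mul, integral_Ioi_id_mul_stdPdf, integral_Ioi_stdPdf,
    integral_Ioi_sq_mul_stdPdf] at h
  nlinarith

lemma neg_id_mul_stdPdf_le (x : ℝ) : -(x * stdPdf x) ≤ (1 + x ^ 2) * stdCdf x := by
  have := id_mul_stdPdf_le (-x)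
  rw [stdCdf_neg, stdPdf_neg] at this
  nlinarith

/-! ### A maximum principle and the sharp bound on the derivative of Stein solutions -/

lemma nonpos_of_second_deriv_eq {q s t u : ℝ → ℝ} (hq : ∀ x, HasDerivAt q (s x) x)
    (hs : ∀ x, HasDerivAt s (t x) x) (ht : ∀ x, HasDerivAt t (u x) x) {K : ℝ}
    (hqK : ∀ x, 0 ≤ x → q x ≤ K) (hs0 : s 0 = 0)
    (hpos : ∀ x, 0 < x → 0 < s x → 0 < u x) : ∀ x, 0 ≤ x → s x ≤ 0 := by
  intro x1 hx1
  by_contra! hs1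
  have hx1' : 0 < x1 := lt_of_le_of_ne hx1 (by rintro rfl; linarith)
  have hcs : Continuous s := continuous_iff_continuousAt.2 fun x => (hs x).continuousAt
  obtain ⟨R, hR1, hR⟩ : ∃ R, x1 < R ∧ s R < s x1 := by
    by_contra! hcon
    set y := x1 + (K - q x1 + 1) / s x1 with hy
    have hK := hqK x1 hx1
    have hxy : x1 < y := by
      have : 0 < (K - q x1 + 1) / s x1 := div_pos (by linarith) hs1
      linarith
    obtain ⟨c, hc, hcq⟩ := exists_hasDerivAt_eq_slope q s hxy
      (fun z _ => (hq z).continuousAt.continuousWithinAt) fun z _ => hq z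
    have h1 := hcon c hc.1
    rw [hcq, le_div_iff₀ (by linarith)] at h1
    have h2 : s x1 * (y - x1) = K - q x1 + 1 := by
      rw [hy]; field_simp; ring
    have h3 := hqK y (by linarith)
    linarith
  obtain ⟨x0, hx0, hmax⟩ := isCompact_Icc.exists_isMaxOn (s := Set.Icc 0 R)
    ⟨0, le_rfl, by linarith⟩ hcs.continuousOn
  have h1 : s x1 ≤ s x0 := hmax ⟨hx1, hR1.le⟩
  have h0 : 0 < x0 := lt_of_le_of_ne hx0.1 (by rintro rfl; linarith)
  have h0R : x0 < R := lt_of_le_of_ne hx0.2 (by rintro rfl; linarith)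
  have hloc : IsLocalMax s x0 := hmax.isLocalMax (Icc_mem_nhds h0 h0R)
  have hd : deriv s = t := funext fun x => (hs x).deriv
  have hdd : deriv (deriv s) = u := by rw [hd]; exact funext fun x => (ht x).deriv
  have hu : 0 < u x0 := hpos x0 h0 (by linarith)
  have hmin : IsLocalMin s x0 := isLocalMin_of_deriv_deriv_pos (by rw [hdd]; exact hu)
    hloc.deriv_eq_zero (hs x0).continuousAt
  have hconst : s =ᶠ[𝓝 x0] fun _ => s x0 := by
    filter_upwards [hloc, hmin] with y hy1 hy2 using le_antisymm hy1 hy2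
  have : deriv (deriv s) x0 = 0 := by
    have h2 : deriv s =ᶠ[𝓝 x0] deriv fun _ => s x0 := hconst.deriv
    rw [h2.deriv_eq]; simp
  rw [hdd] at this
  linarith

lemma hasDerivAt_inv_stdPdf (x : ℝ) :
    HasDerivAt (fun y => (stdPdf y)⁻¹) (x * (stdPdf x)⁻¹) x := by
  have hne := (stdPdf_pos x).ne'
  exact ((hasDerivAt_stdPdf x).inv hne).congr_deriv (by field_simp)

/-- The function `E(x - Z)⁺ E(Z - x)⁺ / ρ(x)`, written out. -/
noncomputable def millsProd (x : ℝ) : ℝ :=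
  (stdPdf x + x * stdCdf x) * (stdPdf x - x * (1 - stdCdf x)) * (stdPdf x)⁻¹

lemma millsProd_eq (x : ℝ) : millsProd x = stdPdf x + x * (2 * stdCdf x - 1)
    - x ^ 2 * (stdCdf x * (1 - stdCdf x) * (stdPdf x)⁻¹) := by
  have hne := (stdPdf_pos x).ne'
  unfold millsProd
  field_simp
  ring

lemma millsProd_neg (x : ℝ) : millsProd (-x) = millsProd x := by
  simp only [millsProd, stdPdf_neg, stdCdf_neg]
  ring

lemma millsProd_nonneg (x : ℝ) : 0 ≤ millsProd x :=
  mul_nonneg (mul_nonneg (by linarith [neg_stdPdf_le_id_mul_stdCdf x])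
    (by linarith [id_mul_one_sub_stdCdf_le x])) (inv_pos.2 (stdPdf_pos x)).le

lemma hasDerivAt_cdf_mul_one_sub_cdf_div (x : ℝ) :
    HasDerivAt (fun y => stdCdf y * (1 - stdCdf y) * (stdPdf y)⁻¹)
      ((1 - 2 * stdCdf x) + x * (stdCdf x * (1 - stdCdf x) * (stdPdf x)⁻¹)) x := by
  have hne := (stdPdf_pos x).ne'
  have h1 := hasDerivAt_stdCdf x
  refine ((h1.mul (h1.const_sub 1)).mul (hasDerivAt_inv_stdPdf x)).congr_deriv ?_
  simp only [Pi.mul_apply]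
  field_simp
  ring

lemma hasDerivAt_mills_combination {a b c : ℝ → ℝ} {a' b' c' x : ℝ} (ha : HasDerivAt a a' x)
    (hb : HasDerivAt b b' x) (hc : HasDerivAt c c' x) :
    HasDerivAt (fun y => a y * stdPdf y + b y * (2 * stdCdf y - 1)
        - c y * (stdCdf y * (1 - stdCdf y) * (stdPdf y)⁻¹))
      ((a' - x * a x + 2 * b x) * stdPdf x + (b' + c x) * (2 * stdCdf x - 1)
        - (c' + x * c x) * (stdCdf x * (1 - stdCdf x) * (stdPdf x)⁻¹)) x := by
  refine (((ha.mul (hasDerivAt_stdPdf x)).add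
    (hb.mul (((hasDerivAt_stdCdf x).const_mul 2).sub_const 1))).sub
    (hc.mul (hasDerivAt_cdf_mul_one_sub_cdf_div x))).congr_deriv ?_
  ring

lemma millsProd_le_of_nonneg {x : ℝ} (hx : 0 ≤ x) : millsProd x ≤ 2 := by
  have h1 := id_mul_stdPdf_le x
  have hρ := stdPdf_pos x
  have h2 : stdPdf x ≤ 1 := (stdPdf_le_zero x).trans stdPdf_zero_le_one
  have h3 : (1 + x ^ 2) * (stdPdf x - x * (1 - stdCdf x)) ≤ stdPdf x := by nlinarith
  have h4 : stdPdf x + x * stdCdf x ≤ 1 + x := by nlinarith [stdCdf_le_one x]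
  have h5 : 0 ≤ stdPdf x - x * (1 - stdCdf x) := by linarith [id_mul_one_sub_stdCdf_le x]
  unfold millsProd
  rw [← div_eq_mul_inv, div_le_iff₀ hρ]
  nlinarith [mul_le_mul_of_nonneg_right h4 h5, sq_nonneg (x - 1)]

lemma millsProd_le_stdPdf_zero (x : ℝ) : millsProd x ≤ stdPdf 0 := by
  wlog hx : 0 ≤ x generalizing x
  · rw [← millsProd_neg]; exact this (-x) (by linarith)
  let q : ℝ → ℝ := fun y => 1 * stdPdf y + y * (2 * stdCdf y - 1)
    - y ^ 2 * (stdCdf y * (1 - stdCdf y) * (stdPdf y)⁻¹)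
  let s : ℝ → ℝ := fun y => y * stdPdf y + (1 + y ^ 2) * (2 * stdCdf y - 1)
    - (2 * y + y ^ 3) * (stdCdf y * (1 - stdCdf y) * (stdPdf y)⁻¹)
  let t : ℝ → ℝ := fun y => (3 + y ^ 2) * stdPdf y + (4 * y + y ^ 3) * (2 * stdCdf y - 1)
    - (2 + 5 * y ^ 2 + y ^ 4) * (stdCdf y * (1 - stdCdf y) * (stdPdf y)⁻¹)
  let u : ℝ → ℝ := fun y => (7 * y + y ^ 3) * stdPdf y
    + (6 + 8 * y ^ 2 + y ^ 4) * (2 * stdCdf y - 1)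
    - (12 * y + 9 * y ^ 3 + y ^ 5) * (stdCdf y * (1 - stdCdf y) * (stdPdf y)⁻¹)
  have hqm : ∀ y, q y = millsProd y := fun y => by rw [millsProd_eq]; simp [q]
  have pw : ∀ (n : ℕ) (y : ℝ), HasDerivAt (fun z : ℝ => z ^ n) (n * y ^ (n - 1)) y :=
    fun n y => hasDerivAt_pow n y
  have hq : ∀ y, HasDerivAt q (s y) y := fun y =>
    (hasDerivAt_mills_combination (hasDerivAt_const y (1 : ℝ)) (hasDerivAt_id y)
      (pw 2 y)).congr_deriv
      (by norm_num; ring)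
  have hs : ∀ y, HasDerivAt s (t y) y := fun y =>
    (hasDerivAt_mills_combination (hasDerivAt_id y) ((pw 2 y).const_add 1)
      (((hasDerivAt_id y).const_mul 2).add (pw 3 y))).congr_deriv
      (by norm_num; ring)
  have ht : ∀ y, HasDerivAt t (u y) y := fun y =>
    (hasDerivAt_mills_combination ((pw 2 y).const_add 3)
      (((hasDerivAt_id y).const_mul 4).add (pw 3 y))
      ((((pw 2 y).const_mul 5).const_add 2).add (pw 4 y))).congr_deriv
      (by norm_num; ring)
  have h0 : stdCdf 0 = 1 / 2 := by
    have := stdCdf_neg 0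
    rw [neg_zero] at this
    linarith
  have hs0 : s 0 = 0 := by simp [s, h0]
  have hsn := nonpos_of_second_deriv_eq hq hs ht (K := 2)
    (fun y hy => by rw [hqm]; exact millsProd_le_of_nonneg hy) hs0 (fun y hy hsy => by
      have : u y = (y ^ 2 + 6) * s y + y * q y := by simp only [u, s, q]; ring
      rw [this]
      have := millsProd_nonneg y
      rw [← hqm] at this
      positivity)
  have hanti : AntitoneOn q (Set.Ici 0) := by
    refine antitoneOn_of_deriv_nonpos (convex_Ici 0)
      (fun y _ => (hq y).continuousAt.continuousWithinAt)
      (fun y _ => (hq y).differentiableAt.differentiableWithinAt) fun y hy => ?_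
    rw [interior_Ici] at hy
    rw [(hq y).deriv]
    exact hsn y hy.le
  have := hanti (Set.mem_Ici.2 le_rfl) (Set.mem_Ici.2 hx) hx
  rw [hqm] at this
  simpa [q] using this

/-! ### Solutions of the Stein equation -/

lemma integrable_lipschitz_mul_stdPdf {h : ℝ → ℝ} (hh : LipschitzWith 1 h) :
    Integrable fun t => h t * stdPdf t := by
  refine ((integrable_stdPdf.const_mul |h 0|).add integrable_id_mul_stdPdf.abs).mono'
    (hh.continuous.mul continuous_stdPdf).aestronglyMeasurable (ae_of_all _ fun t => ?_)
  have h1 : |h t - h 0| ≤ |t| := by simpa [Real.dist_eq] using hh.dist_le_mul t 0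
  have h2 : |h t| ≤ |h 0| + |t| := by
    have := abs_add_le (h t - h 0) (h 0)
    rw [sub_add_cancel] at this
    linarith
  simp only [norm_mul, Real.norm_eq_abs, Pi.add_apply, abs_mul, abs_of_pos (stdPdf_pos t)]
  nlinarith [stdPdf_pos t]

/-- For `1`-Lipschitz `h`, the Stein equation `φ' - xφ = h - E[h(Z)]` has a solution with
`|φ'| ≤ √(2/π)` and `φ'` `2`-Lipschitz. -/
theorem exists_stein_solution_of_lipschitz {h : ℝ → ℝ} (hh : LipschitzWith 1 h) :
    ∃ φ p : ℝ → ℝ, (∀ x, HasDerivAt φ (p x) x) ∧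
      (∀ x, p x = x * φ x + (h x - ∫ t, h t ∂gaussianReal 0 1)) ∧
      (∀ x, |p x| ≤ Real.sqrt (2 / Real.pi)) ∧ (∀ x y, |p y - p x| ≤ 2 * |y - x|) := by
  set c := ∫ t, h t ∂gaussianReal 0 1 with hc
  have hint := integrable_lipschitz_mul_stdPdf hh
  let I : ℝ → ℝ := fun x => ∫ t in Set.Iic x, (h t - c) * stdPdf t
  let φ : ℝ → ℝ := fun x => (stdPdf x)⁻¹ * I x
  let p : ℝ → ℝ := fun x => x * φ x + (h x - c)
  have hint' : Integrable fun t => (h t - c) * stdPdf t := by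
    simp only [sub_mul]; exact hint.sub (integrable_stdPdf.const_mul c)
  have hI : ∀ x, HasDerivAt I ((h x - c) * stdPdf x) x := fun x =>
    hasDerivAt_integral_Iic hint' ((hh.continuous.sub continuous_const).mul continuous_stdPdf) x
  have hφ : ∀ x, HasDerivAt φ (p x) x := fun x => by
    have hne := (stdPdf_pos x).ne'
    refine ((hasDerivAt_inv_stdPdf x).mul (hI x)).congr_deriv ?_
    simp only [p, φ]
    field_simp
  have key : ∀ a, ∃ L R : ℝ, |L| ≤ stdPdf a + a * stdCdf a ∧
      |R| ≤ stdPdf a - a * (1 - stdCdf a) ∧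
      stdPdf a * φ a = (1 - stdCdf a) * L - stdCdf a * R ∧ h a - c = -(L + R) := by
    intro a
    have hia : Integrable fun t => (h t - h a) * stdPdf t := by
      simp only [sub_mul]; exact hint.sub (integrable_stdPdf.const_mul (h a))
    have hb : ∀ t, |(h t - h a) * stdPdf t| ≤ |t - a| * stdPdf t := fun t => by
      rw [abs_mul, abs_of_pos (stdPdf_pos t)]
      refine mul_le_mul_of_nonneg_right ?_ (stdPdf_pos t).le
      simpa [Real.dist_eq] using hh.dist_le_mul t a
    have hsum : (∫ t in Set.Iic a, (h t - h a) * stdPdf t) +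
        (∫ t in Set.Ioi a, (h t - h a) * stdPdf t) = c - h a := by
      rw [integral_Ioi_eq_sub_integral_Iic hia]
      simp only [add_sub_cancel]
      simp only [sub_mul]
      rw [integral_sub hint (integrable_stdPdf.const_mul (h a)), integral_const_mul,
        integral_stdPdf, hc, integral_gaussianReal_eq, mul_one]
    refine ⟨∫ t in Set.Iic a, (h t - h a) * stdPdf t, ∫ t in Set.Ioi a, (h t - h a) * stdPdf t,
      ?_, ?_, ?_, by linarith⟩
    · rw [← integral_Iic_sub_mul_stdPdf, ← Real.norm_eq_abs]
      refine norm_integral_le_of_norm_le ?_ ?_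
      · have : Integrable fun t => (a - t) * stdPdf t := by
          simp only [sub_mul]
          exact (integrable_stdPdf.const_mul a).sub integrable_id_mul_stdPdf
        exact this.integrableOn
      · filter_upwards [ae_restrict_mem measurableSet_Iic] with t ht
        rw [← abs_of_nonneg (sub_nonneg.2 (Set.mem_Iic.1 ht)), abs_sub_comm]
        exact hb t
    · rw [← integral_Ioi_sub_mul_stdPdf, ← Real.norm_eq_abs]
      refine norm_integral_le_of_norm_le ?_ ?_
      · have : Integrable fun t => (t - a) * stdPdf t := by
          simp only [sub_mul]
          exact integrable_id_mul_stdPdf.sub (integrable_stdPdf.const_mul a)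
        exact this.integrableOn
      · filter_upwards [ae_restrict_mem measurableSet_Ioi] with t ht
        rw [← abs_of_nonneg (sub_nonneg.2 (Set.mem_Ioi.1 ht).le)]
        exact hb t
    · have hIa : I a = (∫ t in Set.Iic a, (h t - h a) * stdPdf t) + (h a - c) * stdCdf a := by
        rw [stdCdf_eq_integral, ← integral_const_mul,
          ← integral_add hia.integrableOn (integrable_stdPdf.const_mul _).integrableOn]
        exact integral_congr_ae (ae_of_all _ fun t => by ring)
      have : stdPdf a * φ a = I a := mul_inv_cancel_left₀ (stdPdf_pos a).ne' _
      rw [this, hIa, show h a - c = -((∫ t in Set.Iic a, (h t - h a) * stdPdf t) +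
        (∫ t in Set.Ioi a, (h t - h a) * stdPdf t)) by linarith]
      ring
  have hw : ∀ x, HasDerivAt (fun y => y * φ y) (φ x + x * p x) x := fun x =>
    ((hasDerivAt_id x).mul (hφ x)).congr_deriv (by simp)
  have hwb : ∀ a, |φ a + a * p a| ≤ 1 := fun a => by
    obtain ⟨L, R, hL, hR, h1, h2⟩ := key a
    have hρ := stdPdf_pos a
    have hC : 0 ≤ (1 + a ^ 2) * (1 - stdCdf a) - a * stdPdf a := by linarith [id_mul_stdPdf_le a]
    have hC' : 0 ≤ (1 + a ^ 2) * stdCdf a + a * stdPdf a := by linarith [neg_id_mul_stdPdf_le a]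
    have e : stdPdf a * (φ a + a * p a) = L * ((1 + a ^ 2) * (1 - stdCdf a) - a * stdPdf a)
        - R * ((1 + a ^ 2) * stdCdf a + a * stdPdf a) := by
      have : stdPdf a * (φ a + a * p a) =
        (1 + a ^ 2) * (stdPdf a * φ a) + a * stdPdf a * (h a - c) := by simp only [p]; ring
      rw [this, h1, h2]; ring
    have h3 : |stdPdf a * (φ a + a * p a)| ≤ stdPdf a := by
      rw [e]
      refine (abs_sub _ _).trans ?_
      rw [abs_mul, abs_mul, abs_of_nonneg hC, abs_of_nonneg hC']
      nlinarith [mul_le_mul_of_nonneg_right hL hC, mul_le_mul_of_nonneg_right hR hC']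
    rw [abs_mul, abs_of_pos hρ] at h3
    exact le_of_mul_le_mul_left (by linarith) hρ
  refine ⟨φ, p, hφ, fun x => rfl, fun a => ?_, fun x y => ?_⟩
  · obtain ⟨L, R, hL, hR, h1, h2⟩ := key a
    have hρ := stdPdf_pos a
    have hA : 0 ≤ stdPdf a + a * stdCdf a := by linarith [neg_stdPdf_le_id_mul_stdCdf a]
    have hB : 0 ≤ stdPdf a - a * (1 - stdCdf a) := by linarith [id_mul_one_sub_stdCdf_le a]
    have e : stdPdf a * p a = -((stdPdf a - a * (1 - stdCdf a)) * L)
        - (stdPdf a + a * stdCdf a) * R := by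
      have : stdPdf a * p a = a * (stdPdf a * φ a) + stdPdf a * (h a - c) := by
        simp only [p]; ring
      rw [this, h1, h2]; ring
    have h3 : |stdPdf a * p a| ≤
        2 * ((stdPdf a + a * stdCdf a) * (stdPdf a - a * (1 - stdCdf a))) := by
      rw [e]
      refine (abs_sub _ _).trans ?_
      rw [abs_neg, abs_mul, abs_mul, abs_of_nonneg hA, abs_of_nonneg hB]
      nlinarith [mul_le_mul_of_nonneg_left hL hB, mul_le_mul_of_nonneg_left hR hA]
    have h4 := millsProd_le_stdPdf_zero a
    rw [millsProd, ← div_eq_mul_inv, div_le_iff₀ hρ] at h4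
    rw [abs_mul, abs_of_pos hρ] at h3
    rw [← two_mul_stdPdf_zero]
    exact le_of_mul_le_mul_left (by linarith) hρ
  · have h1 : |y * φ y - x * φ x| ≤ 1 * |y - x| :=
      convex_univ.norm_image_sub_le_of_norm_hasDerivWithin_le
        (fun z _ => (hw z).hasDerivWithinAt) (fun z _ => hwb z) (Set.mem_univ x) (Set.mem_univ y)
    have h2 : |h y - h x| ≤ |y - x| := by simpa [Real.dist_eq] using hh.dist_le_mul y x
    have h3 : p y - p x = (y * φ y - x * φ x) + (h y - h x) := by simp only [p]; ring
    rw [h3]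
    exact (abs_add_le _ _).trans (by linarith)

/-- Second order Taylor estimate for a function whose derivative is `2`-Lipschitz. -/
lemma abs_sub_sub_mul_le_sq {φ p : ℝ → ℝ} (hφ : ∀ x, HasDerivAt φ (p x) x)
    (hp : ∀ x y, |p y - p x| ≤ 2 * |y - x|) (x y : ℝ) :
    |φ y - φ x - p x * (y - x)| ≤ (y - x) ^ 2 := by
  set d := y - x with hd
  have hx : ∀ r : ℝ, HasDerivAt (fun r => x + r * d) d r := fun r =>
    (((hasDerivAt_id r).mul_const d).const_add x).congr_deriv (by simp)
  have h1 : ∀ r : ℝ, HasDerivAt (fun r => φ (x + r * d) - φ x - p x * (r * d))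
      (p (x + r * d) * d - p x * d) r := fun r =>
    ((((hφ (x + r * d)).comp r (hx r)).sub_const (φ x)).sub
      (((hasDerivAt_id r).mul_const d).const_mul (p x))).congr_deriv (by simp)
  have h2 : ∀ r : ℝ, HasDerivAt (fun r => d ^ 2 * r ^ 2) (d ^ 2 * (2 * r)) r := fun r =>
    ((hasDerivAt_pow 2 r).const_mul (d ^ 2)).congr_deriv (by simp)
  have h := image_norm_le_of_norm_deriv_right_le_deriv_boundary (a := 0) (b := 1)
    (fun r _ => (h1 r).continuousAt.continuousWithinAt) (fun r _ => (h1 r).hasDerivWithinAt)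
    (B := fun r => d ^ 2 * r ^ 2) (by simp) h2 (fun r hr => by
      rw [← sub_mul, Real.norm_eq_abs, abs_mul]
      have := hp x (x + r * d)
      rw [add_sub_cancel_left, abs_mul, abs_of_nonneg hr.1] at this
      have h5 : |d| * |d| = d ^ 2 := by rw [← sq, sq_abs]
      calc _ ≤ 2 * (r * |d|) * |d| := mul_le_mul_of_nonneg_right this (abs_nonneg d)
        _ = d ^ 2 * (2 * r) := by rw [← h5]; ring) (x := 1) ⟨zero_le_one, le_rfl⟩
  simpa [hd] using h

lemma hasDerivAt_id_mul_stdCdf_div (x : ℝ) :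
    HasDerivAt (fun y => y * (stdCdf y * (stdPdf y)⁻¹))
      (((1 + x ^ 2) * stdCdf x + x * stdPdf x) * (stdPdf x)⁻¹) x := by
  have hne := (stdPdf_pos x).ne'
  refine ((hasDerivAt_id x).mul
    ((hasDerivAt_stdCdf x).mul (hasDerivAt_inv_stdPdf x))).congr_deriv ?_
  simp only [id, Pi.mul_apply]
  field_simp
  ring

lemma hasDerivAt_id_mul_one_sub_stdCdf_div (x : ℝ) :
    HasDerivAt (fun y => y * ((1 - stdCdf y) * (stdPdf y)⁻¹))
      (((1 + x ^ 2) * (1 - stdCdf x) - x * stdPdf x) * (stdPdf x)⁻¹) x := by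
  have hne := (stdPdf_pos x).ne'
  refine ((hasDerivAt_id x).mul
    (((hasDerivAt_stdCdf x).const_sub 1).mul (hasDerivAt_inv_stdPdf x))).congr_deriv ?_
  simp only [id, Pi.mul_apply]
  field_simp
  ring

lemma monotone_id_mul_stdCdf_div : Monotone fun y => y * (stdCdf y * (stdPdf y)⁻¹) :=
  monotone_of_deriv_nonneg (fun x => (hasDerivAt_id_mul_stdCdf_div x).differentiableAt) fun x => by
    rw [(hasDerivAt_id_mul_stdCdf_div x).deriv]
    exact mul_nonneg (by linarith [neg_id_mul_stdPdf_le x]) (inv_pos.2 (stdPdf_pos x)).le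

lemma monotone_id_mul_one_sub_stdCdf_div :
    Monotone fun y => y * ((1 - stdCdf y) * (stdPdf y)⁻¹) :=
  monotone_of_deriv_nonneg (fun x => (hasDerivAt_id_mul_one_sub_stdCdf_div x).differentiableAt)
    fun x => by
      rw [(hasDerivAt_id_mul_one_sub_stdCdf_div x).deriv]
      exact mul_nonneg (by linarith [id_mul_stdPdf_le x]) (inv_pos.2 (stdPdf_pos x)).le

lemma neg_one_le_id_mul_stdCdf_div (x : ℝ) : -1 ≤ x * (stdCdf x * (stdPdf x)⁻¹) := by
  rw [← mul_assoc, ← div_eq_mul_inv, le_div_iff₀ (stdPdf_pos x)]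
  linarith [neg_stdPdf_le_id_mul_stdCdf x]

lemma id_mul_one_sub_stdCdf_div_le_one (x : ℝ) :
    x * ((1 - stdCdf x) * (stdPdf x)⁻¹) ≤ 1 := by
  rw [← mul_assoc, ← div_eq_mul_inv, div_le_iff₀ (stdPdf_pos x)]
  linarith [id_mul_one_sub_stdCdf_le x]

open Classical in
/-- The Stein equation for the indicator of `(-∞, z]` has a solution `φ` with derivative `p`
(except at `z`), `|p| ≤ 1`, whose Taylor remainder is controlled by the increments of a
monotone function with values in `[-1, 1]`. -/
theorem exists_stein_solution_indicator (z : ℝ) :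
    ∃ φ p ζ : ℝ → ℝ, Continuous φ ∧ Measurable p ∧ Monotone ζ ∧ (∀ x, |ζ x| ≤ 1) ∧
      (∀ x, |p x| ≤ 1) ∧ (∀ x, p x = x * φ x + ((Set.Iic z).indicator 1 x - stdCdf z)) ∧
      ∀ x y, |φ y - φ x - p x * (y - x)| ≤ (y - x) * (ζ y - ζ x) := by
  let φ : ℝ → ℝ := fun x => if x ≤ z then stdCdf x * (stdPdf x)⁻¹ * (1 - stdCdf z)
    else (1 - stdCdf x) * (stdPdf x)⁻¹ * stdCdf z
  let p : ℝ → ℝ := fun x => x * φ x + ((Set.Iic z).indicator 1 x - stdCdf z)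
  let ζ : ℝ → ℝ := fun x => x * φ x + ((Set.Ioi z).indicator 1 x - stdCdf z)
  have hz0 := stdCdf_nonneg z
  have hz1 := stdCdf_le_one z
  have hcinv : Continuous fun x => (stdPdf x)⁻¹ :=
    continuous_stdPdf.inv₀ fun x => (stdPdf_pos x).ne'
  have hφc : Continuous φ := by
    refine Continuous.if_le ((continuous_stdCdf.mul hcinv).mul continuous_const)
      (((continuous_const.sub continuous_stdCdf).mul hcinv).mul continuous_const)
      continuous_id continuous_const ?_
    rintro x rfl
    ring
  have hle : ∀ x, x ≤ z → x * φ x = (1 - stdCdf z) * (x * (stdCdf x * (stdPdf x)⁻¹)) :=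
    fun x hx => by simp only [φ, if_pos hx]; ring
  have hge : ∀ x, z ≤ x → x * φ x = stdCdf z * (x * ((1 - stdCdf x) * (stdPdf x)⁻¹)) := by
    intro x hx
    rcases hx.eq_or_lt with rfl | hx
    · rw [hle _ le_rfl]; ring
    · simp only [φ, if_neg (not_le.2 hx)]; ring
  have hmono : Monotone fun x => x * φ x := by
    have h1 : MonotoneOn (fun x => x * φ x) (Set.Iic z) := fun x hx y hy hxy => by
      simp only [hle x hx, hle y hy]
      exact mul_le_mul_of_nonneg_left (monotone_id_mul_stdCdf_div hxy) (by linarith)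
    have h2 : MonotoneOn (fun x => x * φ x) (Set.Ici z) := fun x hx y hy hxy => by
      simp only [hge x hx, hge y hy]
      exact mul_le_mul_of_nonneg_left (monotone_id_mul_one_sub_stdCdf_div hxy) hz0
    exact h1.Iic_union_Ici h2
  have hup : ∀ x, x * φ x ≤ stdCdf z := fun x => by
    refine (hmono (le_max_left x z)).trans ?_
    change max x z * φ (max x z) ≤ _
    rw [hge _ (le_max_right x z)]
    nlinarith [id_mul_one_sub_stdCdf_div_le_one (max x z)]
  have hlow : ∀ x, -(1 - stdCdf z) ≤ x * φ x := fun x => by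
    refine le_trans ?_ (hmono (min_le_left x z))
    change _ ≤ min x z * φ (min x z)
    rw [hle _ (min_le_right x z)]
    nlinarith [neg_one_le_id_mul_stdCdf_div (min x z)]
  have hpm : Measurable p := (measurable_id.mul hφc.measurable).add
    ((measurable_one.indicator measurableSet_Iic).sub measurable_const)
  have hpb : ∀ x, |p x| ≤ 1 := fun x => by
    have h1 := hup x
    have h2 := hlow x
    by_cases hx : x ≤ z
    · have : p x = x * φ x + (1 - stdCdf z) := by simp [p, hx]
      rw [this, abs_le]; constructor <;> linarith
    · have : p x = x * φ x - stdCdf z := by simp [p, hx]; ring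
      rw [this, abs_le]; constructor <;> linarith
  have hζm : Monotone ζ := by
    refine hmono.add fun x y hxy => sub_le_sub_right ?_ _
    by_cases hx : z < x
    · have hy : z < y := hx.trans_le hxy
      simp [hx, hy]
    · simp only [Set.indicator_apply, Set.mem_Ioi, hx, if_false]
      split_ifs <;> simp
  have hζb : ∀ x, |ζ x| ≤ 1 := fun x => by
    have h1 := hup x
    have h2 := hlow x
    by_cases hx : z < x
    · have : ζ x = x * φ x + (1 - stdCdf z) := by simp [ζ, hx]
      rw [this, abs_le]; constructor <;> linarith
    · have : ζ x = x * φ x - stdCdf z := by simp [ζ, hx]; ring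
      rw [this, abs_le]; constructor <;> linarith
  have hderiv : ∀ x, x ≠ z → HasDerivAt φ (p x) x := by
    intro x hx
    have hne := (stdPdf_pos x).ne'
    rcases lt_or_gt_of_ne hx with h | h
    · have h1 : HasDerivAt (fun y => stdCdf y * (stdPdf y)⁻¹ * (1 - stdCdf z)) (p x) x := by
        refine (((hasDerivAt_stdCdf x).mul (hasDerivAt_inv_stdPdf x)).mul_const
          (1 - stdCdf z)).congr_deriv ?_
        simp only [p, φ, h.le, if_true, Set.indicator_apply, Set.mem_Iic, Pi.one_apply]
        field_simp
        ring
      refine h1.congr_of_eventuallyEq ?_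
      filter_upwards [Iio_mem_nhds h] with y hy
      simp only [φ, if_pos (le_of_lt (Set.mem_Iio.1 hy))]
    · have h1 : HasDerivAt (fun y => (1 - stdCdf y) * (stdPdf y)⁻¹ * stdCdf z) (p x) x := by
        refine ((((hasDerivAt_stdCdf x).const_sub 1).mul (hasDerivAt_inv_stdPdf x)).mul_const
          (stdCdf z)).congr_deriv ?_
        simp only [p, φ, not_le.2 h, if_false, Set.indicator_apply, Set.mem_Iic]
        field_simp
        ring
      refine h1.congr_of_eventuallyEq ?_
      filter_upwards [Ioi_mem_nhds h] with y hy
      simp only [φ, if_neg (not_le.2 (Set.mem_Ioi.1 hy))]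
  have hinc : ∀ s t, s ≤ t → |p t - p s| ≤ ζ t - ζ s := by
    intro s t hst
    have h1 := hmono hst
    simp only at h1
    by_cases hs : s ≤ z <;> by_cases ht : t ≤ z
    · simp only [p, ζ, Set.indicator_apply, Set.mem_Iic, Set.mem_Ioi, hs, ht, not_lt.2 hs,
        not_lt.2 ht, if_true, if_false, Pi.one_apply]
      rw [abs_le]; constructor <;> linarith
    · simp only [p, ζ, Set.indicator_apply, Set.mem_Iic, Set.mem_Ioi, hs, ht, not_lt.2 hs,
        not_le.1 ht, if_true, if_false, Pi.one_apply]
      rw [abs_le]; constructor <;> linarith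
    · exact absurd (hst.trans ht) hs
    · simp only [p, ζ, Set.indicator_apply, Set.mem_Iic, Set.mem_Ioi, hs, ht, not_le.1 hs,
        not_le.1 ht, if_true, if_false, Pi.one_apply]
      rw [abs_le]; constructor <;> linarith
  have hinc' : ∀ s t, |p t - p s| ≤ |ζ t - ζ s| := fun s t => by
    rcases le_total s t with h | h
    · exact (hinc s t h).trans (le_abs_self _)
    · rw [abs_sub_comm, abs_sub_comm (ζ t)]
      exact (hinc t s h).trans (le_abs_self _)
  refine ⟨φ, p, ζ, hφc, hpm, hζm, hζb, hpb, fun x => rfl, fun x y => ?_⟩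
  have hii : IntervalIntegrable p volume x y := by
    rw [intervalIntegrable_iff]
    exact Measure.integrableOn_of_bounded (M := 1) (by simp) hpm.aestronglyMeasurable
      (ae_of_all _ hpb)
  have h1 : φ y - φ x - p x * (y - x) = ∫ t in x..y, (p t - p x) := by
    rw [intervalIntegral.integral_sub hii intervalIntegrable_const,
      integral_eq_of_hasDerivAt_off_countable φ p (Set.countable_singleton z) hφc.continuousOn
        (fun t ht => hderiv t ht.2) hii]
    simp [mul_comm]
  have h2 : (y - x) * (ζ y - ζ x) = |ζ y - ζ x| * |y - x| := by
    rw [← abs_mul, mul_comm, abs_of_nonneg]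
    rcases le_total x y with h | h
    · exact mul_nonneg (sub_nonneg.2 (hζm h)) (sub_nonneg.2 h)
    · exact mul_nonneg_of_nonpos_of_nonpos (sub_nonpos.2 (hζm h)) (sub_nonpos.2 h)
  rw [h1, h2, ← Real.norm_eq_abs]
  refine intervalIntegral.norm_integral_le_of_norm_le_const fun t ht => ?_
  rw [Real.norm_eq_abs]
  refine (hinc' x t).trans ?_
  rcases le_total x y with h | h
  · rw [Set.uIoc_of_le h] at ht
    rw [abs_of_nonneg (sub_nonneg.2 (hζm ht.1.le)), abs_of_nonneg (sub_nonneg.2 (hζm h))]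
    linarith [hζm ht.2]
  · rw [Set.uIoc_of_ge h] at ht
    rw [abs_of_nonpos (sub_nonpos.2 (hζm ht.2)), abs_of_nonpos (sub_nonpos.2 (hζm h))]
    linarith [hζm ht.1.le]

lemma MeasureTheory.MemLp.integrable_fun_mul {α : Type*} [MeasurableSpace α] {μ : Measure α}
    {f g : α → ℝ} (hf : MemLp f 2 μ) (hg : MemLp g 2 μ) : Integrable (fun x => f x * g x) μ :=
  hf.integrable_mul hg

lemma MeasureTheory.MemLp.fun_sub {α : Type*} [MeasurableSpace α] {μ : Measure α}
    {f g : α → ℝ} (hf : MemLp f 2 μ) (hg : MemLp g 2 μ) : MemLp (fun x => f x - g x) 2 μ :=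
  hf.sub hg

/-! ### Exchanging coordinates of two independent sequences -/

section Exchange

variable {E : ℕ → Type*}

open Classical in
/-- The sequence with the coordinates of `y` on `A` and those of `x` off `A`. -/
noncomputable def mixOn (A : Set ℕ) (y x : ∀ n, E n) : ∀ n, E n :=
  fun i => if i ∈ A then y i else x i

lemma mixOn_of_mem {A : Set ℕ} {i : ℕ} (h : i ∈ A) (y x : ∀ n, E n) : mixOn A y x i = y i :=
  if_pos h

lemma mixOn_of_notMem {A : Set ℕ} {i : ℕ} (h : i ∉ A) (y x : ∀ n, E n) : mixOn A y x i = x i :=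
  if_neg h

lemma mixOn_singleton (k : ℕ) (y x : ∀ n, E n) : mixOn {k} y x = Function.update x k (y k) := by
  ext i
  by_cases h : i = k
  · subst h; simp [mixOn]
  · simp [mixOn, h]

/-- Exchange the coordinates with index in `A` of two sequences. -/
noncomputable def swapOn (A : Set ℕ) (z : (∀ n, E n) × (∀ n, E n)) : (∀ n, E n) × (∀ n, E n) :=
  (mixOn A z.2 z.1, mixOn A z.1 z.2)

variable [∀ n, MeasurableSpace (E n)]

lemma Measurable.mixOn {α : Type*} [MeasurableSpace α] {f g : α → ∀ n, E n} (A : Set ℕ)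
    (hf : Measurable f) (hg : Measurable g) : Measurable fun a => mixOn A (f a) (g a) := by
  refine measurable_pi_lambda _ fun i => ?_
  by_cases h : i ∈ A
  · simpa [_root_.mixOn, h] using measurable_pi_iff.1 hf i
  · simpa [_root_.mixOn, h] using measurable_pi_iff.1 hg i

lemma measurable_swapOn (A : Set ℕ) : Measurable (swapOn (E := E) A) :=
  (Measurable.mixOn A measurable_snd measurable_fst).prodMk
    (Measurable.mixOn A measurable_fst measurable_snd)

variable (μ : ∀ n, Measure (E n)) [∀ n, IsProbabilityMeasure (μ n)]

lemma prod_infinitePi_swapOn_preimage_box (A : Set ℕ) (s : Finset ℕ) (t t' : ∀ i, Set (E i))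
    (ht : ∀ i, MeasurableSet (t i)) (ht' : ∀ i, MeasurableSet (t' i)) :
    ((Measure.infinitePi μ).prod (Measure.infinitePi μ))
      (swapOn A ⁻¹' (Set.pi s t ×ˢ Set.pi s t')) =
    Measure.infinitePi μ (Set.pi s t) * Measure.infinitePi μ (Set.pi s t') := by
  classical
  have h : swapOn A ⁻¹' (Set.pi (s : Set ℕ) t ×ˢ Set.pi s t') =
      Set.pi (s : Set ℕ) (fun i => if i ∈ A then t' i else t i) ×ˢ
        Set.pi s (fun i => if i ∈ A then t i else t' i) := by
    ext ⟨x, y⟩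
    simp only [swapOn, mixOn, Set.mem_preimage, Set.mem_prod, Set.mem_pi, ← forall_and]
    refine forall_congr' fun i => ?_
    by_cases hi : i ∈ A
    · simp only [hi, if_true]; tauto
    · simp only [hi, if_false]
  have h1 : ∀ i, MeasurableSet (if i ∈ A then t' i else t i) := fun i => by
    split_ifs; exacts [ht' i, ht i]
  have h2 : ∀ i, MeasurableSet (if i ∈ A then t i else t' i) := fun i => by
    split_ifs; exacts [ht i, ht' i]
  rw [h, Measure.prod_prod, Measure.infinitePi_pi _ fun i _ => h1 i,
    Measure.infinitePi_pi _ fun i _ => h2 i, Measure.infinitePi_pi _ fun i _ => ht i,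
    Measure.infinitePi_pi _ fun i _ => ht' i, ← Finset.prod_mul_distrib, ← Finset.prod_mul_distrib]
  refine Finset.prod_congr rfl fun i _ => ?_
  split_ifs
  · rw [mul_comm]
  · rfl

theorem measurePreserving_swapOn (A : Set ℕ) :
    MeasurePreserving (swapOn A) ((Measure.infinitePi μ).prod (Measure.infinitePi μ))
      ((Measure.infinitePi μ).prod (Measure.infinitePi μ)) := by
  classical
  refine ⟨measurable_swapOn A, ?_⟩
  set C : Set (Set (∀ n, E n)) := squareCylinders fun i => {s : Set (E i) | MeasurableSet s}
  have hC : MeasurableSpace.generateFrom C = MeasurableSpace.pi := generateFrom_squareCylinders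
  have hpi : IsPiSystem C :=
    isPiSystem_squareCylinders (fun i => MeasurableSpace.isPiSystem_measurableSet) (by simp)
  have huniv : Set.univ ∈ C := ⟨∅, fun _ => Set.univ, by simp, by simp⟩
  let hsp : (Measure.infinitePi μ).FiniteSpanningSetsIn C :=
    ⟨fun _ => Set.univ, fun _ => huniv, fun _ => measure_lt_top _ _, Set.iUnion_const _⟩
  refine (Measure.prod_eq_generateFrom hC hC hpi hpi hsp hsp ?_).symm
  rintro _ ⟨s, t, ht, rfl⟩ _ ⟨s', t', ht', rfl⟩
  simp only [Set.mem_pi, Set.mem_univ, true_imp_iff, Set.mem_ofPred_eq] at ht ht'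
  have e1 : Set.pi (s : Set ℕ) t
      = Set.pi ((s ∪ s' : Finset ℕ) : Set ℕ) fun i => if i ∈ s then t i else Set.univ := by
    ext x
    simp only [Set.mem_pi, Finset.coe_union, Set.mem_union, Finset.mem_coe]
    refine forall_congr' fun i => ?_
    by_cases hi : i ∈ s <;> simp [hi]
  have e2 : Set.pi (s' : Set ℕ) t'
      = Set.pi ((s ∪ s' : Finset ℕ) : Set ℕ) fun i => if i ∈ s' then t' i else Set.univ := by
    ext x
    simp only [Set.mem_pi, Finset.coe_union, Set.mem_union, Finset.mem_coe]
    refine forall_congr' fun i => ?_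
    by_cases hi : i ∈ s' <;> simp [hi]
  have hm1 : ∀ i, MeasurableSet (if i ∈ s then t i else Set.univ) := fun i => by
    split_ifs; exacts [ht i, .univ]
  have hm2 : ∀ i, MeasurableSet (if i ∈ s' then t' i else Set.univ) := fun i => by
    split_ifs; exacts [ht' i, .univ]
  rw [e1, e2, Measure.map_apply (measurable_swapOn A)
    ((MeasurableSet.pi (Set.to_countable _) fun i _ => hm1 i).prod
      (MeasurableSet.pi (Set.to_countable _) fun i _ => hm2 i)),
    prod_infinitePi_swapOn_preimage_box μ A _ _ _ hm1 hm2]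

theorem measurePreserving_mixOn (A : Set ℕ) :
    MeasurePreserving (fun z : (∀ n, E n) × (∀ n, E n) => mixOn A z.2 z.1)
      ((Measure.infinitePi μ).prod (Measure.infinitePi μ)) (Measure.infinitePi μ) :=
  measurePreserving_fst.comp (measurePreserving_swapOn μ A)

lemma integral_comp_swapOn (A : Set ℕ) {Ψ : (∀ n, E n) × (∀ n, E n) → ℝ} (hΨ : Measurable Ψ) :
    ∫ z, Ψ (swapOn A z) ∂(Measure.infinitePi μ).prod (Measure.infinitePi μ)
      = ∫ z, Ψ z ∂(Measure.infinitePi μ).prod (Measure.infinitePi μ) := by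
  have h := measurePreserving_swapOn μ A
  conv_rhs => rw [← h.map_eq]
  rw [integral_map h.measurable.aemeasurable hΨ.aestronglyMeasurable]

/-- **Efron–Stein inequality** for functions of the first `n` coordinates. -/
theorem efron_stein_of_dependsOn {f : (∀ n, E n) → ℝ} (hfm : Measurable f)
    (hf : MemLp f 2 (Measure.infinitePi μ)) (n : ℕ) (hdep : DependsOn f (Set.Iio n)) :
    ∫ x, f x ^ 2 ∂Measure.infinitePi μ - (∫ x, f x ∂Measure.infinitePi μ) ^ 2 ≤
      ∑ k ∈ Finset.range n, (1 / 2) * ∫ z, (f (mixOn {k} z.2 z.1) - f z.1) ^ 2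
        ∂(Measure.infinitePi μ).prod (Measure.infinitePi μ) := by
  set M := Measure.infinitePi μ
  set ν := M.prod M
  let e : ℕ → (∀ n, E n) × (∀ n, E n) → ℝ := fun j z => f (mixOn (Set.Iio j) z.2 z.1)
  have hem : ∀ j, Measurable (e j) := fun j =>
    hfm.comp (Measurable.mixOn _ measurable_snd measurable_fst)
  have he : ∀ j, MemLp (e j) 2 ν := fun j =>
    hf.comp_measurePreserving (measurePreserving_mixOn μ (Set.Iio j))
  have he0 : ∀ z, e 0 z = f z.1 := fun z => by
    simp only [e]; congr 1; ext i; simp [mixOn]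
  have hen : ∀ z, e n z = f z.2 := fun z =>
    hdep fun i hi => mixOn_of_mem hi _ _
  have h1 : MemLp (fun z : (∀ n, E n) × (∀ n, E n) => f z.1) 2 ν :=
    hf.comp_measurePreserving measurePreserving_fst
  have h2 : MemLp (fun z : (∀ n, E n) × (∀ n, E n) => f z.2) 2 ν :=
    hf.comp_measurePreserving measurePreserving_snd
  have hL : ∫ x, f x ^ 2 ∂M - (∫ x, f x ∂M) ^ 2 = ∫ z, f z.1 * (f z.1 - f z.2) ∂ν := by
    have a1 : ∫ x, f x ^ 2 ∂M = ∫ z, f z.1 * f z.1 ∂ν := by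
      have hp : MeasurePreserving Prod.fst ν M := measurePreserving_fst
      rw [← hp.map_eq, integral_map hp.measurable.aemeasurable (hfm.pow_const 2).aestronglyMeasurable]
      simp only [sq]
    have a2 : (∫ x, f x ∂M) ^ 2 = ∫ z, f z.1 * f z.2 ∂ν := by
      rw [integral_prod_mul (μ := M) (ν := M) f f, sq]
    rw [a1, a2, ← integral_sub (h1.integrable_fun_mul h1) (h1.integrable_fun_mul h2)]
    simp only [mul_sub]
  have hR : ∫ z, f z.1 * (f z.1 - f z.2) ∂ν
      = ∑ k ∈ Finset.range n, ∫ z, f z.1 * (e k z - e (k + 1) z) ∂ν := by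
    rw [← integral_finsetSum _ fun k _ => h1.integrable_fun_mul ((he k).fun_sub (he (k + 1)))]
    refine integral_congr_ae (ae_of_all _ fun z => ?_)
    simp only
    rw [← Finset.mul_sum, Finset.sum_range_sub', he0, hen]
  rw [hL, hR]
  refine Finset.sum_le_sum fun k _ => ?_
  set d : (∀ n, E n) × (∀ n, E n) → ℝ := fun z => f (mixOn {k} z.2 z.1) - f z.1 with hd
  have hk : MemLp (fun z : (∀ n, E n) × (∀ n, E n) => f (mixOn {k} z.2 z.1)) 2 ν :=
    hf.comp_measurePreserving (measurePreserving_mixOn μ {k})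
  have hkm : Measurable fun z : (∀ n, E n) × (∀ n, E n) => f (mixOn {k} z.2 z.1) :=
    hfm.comp (Measurable.mixOn _ measurable_snd measurable_fst)
  have hdm : MemLp d 2 ν := hk.sub h1
  have hdd : MemLp (fun z => e k z - e (k + 1) z) 2 ν := (he k).sub (he (k + 1))
  have swap1 : ∀ z : (∀ n, E n) × (∀ n, E n), e k (swapOn {k} z) = e (k + 1) z := fun z => by
    simp only [e, swapOn]; congr 1; ext i
    simp only [mixOn, Set.mem_Iio, Set.mem_singleton_iff]
    split_ifs <;> first | rfl | omega
  have swap2 : ∀ z : (∀ n, E n) × (∀ n, E n), e (k + 1) (swapOn {k} z) = e k z := fun z => by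
    simp only [e, swapOn]; congr 1; ext i
    simp only [mixOn, Set.mem_Iio, Set.mem_singleton_iff]
    split_ifs <;> first | rfl | omega
  have s1 : ∫ z, f z.1 * (e k z - e (k + 1) z) ∂ν
      = ∫ z, f (mixOn {k} z.2 z.1) * (e (k + 1) z - e k z) ∂ν := by
    rw [← integral_comp_swapOn μ {k} (Ψ := fun z => f z.1 * (e k z - e (k + 1) z))
      ((hfm.comp measurable_fst).mul ((hem k).sub (hem (k + 1))))]
    simp only [swap1, swap2]
    rfl
  have s2 : ∫ z, (e k z - e (k + 1) z) ^ 2 ∂ν = ∫ z, d z ^ 2 ∂ν := by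
    rw [← integral_comp_swapOn μ (Set.Iio k) (Ψ := fun z => d z ^ 2)
      ((hkm.sub (hfm.comp measurable_fst)).pow_const 2)]
    refine integral_congr_ae (ae_of_all _ fun z => ?_)
    have : mixOn {k} (swapOn (Set.Iio k) z).2 (swapOn (Set.Iio k) z).1
        = mixOn (Set.Iio (k + 1)) z.2 z.1 := by
      ext i
      simp only [swapOn, mixOn, Set.mem_Iio, Set.mem_singleton_iff]
      split_ifs <;> first | rfl | omega
    simp only [hd, this]
    simp only [e, swapOn]
    ring
  have s3 : 2 * ∫ z, f z.1 * (e k z - e (k + 1) z) ∂ν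
      = -∫ z, d z * (e k z - e (k + 1) z) ∂ν := by
    rw [two_mul]
    nth_rewrite 2 [s1]
    rw [← integral_add (h1.integrable_fun_mul hdd)
      (hk.integrable_fun_mul ((he (k + 1)).fun_sub (he k))), ← integral_neg]
    refine integral_congr_ae (ae_of_all _ fun z => ?_)
    simp only [hd]
    ring
  have s4 : -∫ z, d z * (e k z - e (k + 1) z) ∂ν
      ≤ (1 / 2) * ∫ z, d z ^ 2 ∂ν + (1 / 2) * ∫ z, (e k z - e (k + 1) z) ^ 2 ∂ν := by
    rw [← integral_neg, ← integral_const_mul, ← integral_const_mul,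
      ← integral_add (hdm.integrable_sq.const_mul _) (hdd.integrable_sq.const_mul _)]
    refine integral_mono (hdm.integrable_fun_mul hdd).neg
      ((hdm.integrable_sq.const_mul _).add (hdd.integrable_sq.const_mul _)) fun z => ?_
    simp only
    nlinarith [sq_nonneg (d z + (e k z - e (k + 1) z))]
  rw [s2] at s4
  linarith

end Exchange

/-! ### Square-integrable random variables and their conditional expectations -/

section SquareIntegrable

variable {Ω : Type*} {m m0 : MeasurableSpace Ω} {P : Measure Ω}

lemma lintegral_enorm_sq_eq_ofReal {H : Ω → ℝ} (hH : MemLp H 2 P) :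
    ∫⁻ ω, ‖H ω‖ₑ ^ 2 ∂P = ENNReal.ofReal (∫ ω, H ω ^ 2 ∂P) := by
  rw [ofReal_integral_eq_lintegral_ofReal hH.integrable_sq (ae_of_all _ fun ω => sq_nonneg _)]
  refine lintegral_congr fun ω => ?_
  rw [← sq_abs, ENNReal.ofReal_pow (abs_nonneg _), ← Real.norm_eq_abs, ofReal_norm]

lemma memLp_two_of_lintegral_lt_top {H : Ω → ℝ} (hm : AEStronglyMeasurable H P)
    (hH : ∫⁻ ω, ‖H ω‖ₑ ^ 2 ∂P < ∞) : MemLp H 2 P := by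
  refine ⟨hm, ?_⟩
  rw [eLpNorm_lt_top_iff_lintegral_rpow_enorm_lt_top (by norm_num) (by norm_num)]
  simpa using hH

lemma lintegral_enorm_sq_sub_le {a b c : Ω → ℝ} (hac : AEStronglyMeasurable (fun ω => a ω - c ω) P) :
    ∫⁻ ω, ‖a ω - b ω‖ₑ ^ 2 ∂P
      ≤ 2 * ∫⁻ ω, ‖a ω - c ω‖ₑ ^ 2 ∂P + 2 * ∫⁻ ω, ‖c ω - b ω‖ₑ ^ 2 ∂P := by
  rw [← lintegral_const_mul' _ _ (by norm_num), ← lintegral_const_mul' _ _ (by norm_num),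
    ← lintegral_add_left' ((hac.enorm.pow_const 2).const_mul 2)]
  refine lintegral_mono fun ω => ?_
  have h : ∀ x : ℝ, ‖x‖ₑ ^ 2 = ENNReal.ofReal (x ^ 2) := fun x => by
    rw [← sq_abs, ENNReal.ofReal_pow (abs_nonneg _), ← Real.norm_eq_abs, ofReal_norm]
  rw [h, h, h, show (2 : ℝ≥0∞) = ENNReal.ofReal 2 by simp, ← ENNReal.ofReal_mul (by norm_num),
    ← ENNReal.ofReal_mul (by norm_num), ← ENNReal.ofReal_add (by positivity) (by positivity)]
  refine ENNReal.ofReal_le_ofReal ?_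
  nlinarith [sq_nonneg ((a ω - c ω) - (c ω - b ω))]

variable [IsProbabilityMeasure P]

lemma integral_condExp_mul (hm : m ≤ m0) {F G : Ω → ℝ} (hF : MemLp F 2 P) (hG : MemLp G 2 P) :
    ∫ ω, (P[F | m]) ω * G ω ∂P = ∫ ω, (P[F | m]) ω * (P[G | m]) ω ∂P := by
  have hFm : MemLp (P[F | m]) 2 P := hF.condExp one_le_two
  rw [← integral_condExp hm]
  refine integral_congr_ae ?_
  exact condExp_mul_of_stronglyMeasurable_left stronglyMeasurable_condExp
    (hFm.integrable_mul hG) (hG.integrable one_le_two)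

lemma integral_sub_condExp_mul_sub_condExp (hm : m ≤ m0) {F G : Ω → ℝ} (hF : MemLp F 2 P)
    (hG : MemLp G 2 P) :
    ∫ ω, (F ω - (P[F | m]) ω) * (G ω - (P[G | m]) ω) ∂P
      = ∫ ω, F ω * G ω ∂P - ∫ ω, F ω * (P[G | m]) ω ∂P := by
  have hFm : MemLp (P[F | m]) 2 P := hF.condExp one_le_two
  have hGm : MemLp (P[G | m]) 2 P := hG.condExp one_le_two
  have h0 : ∫ ω, (P[F | m]) ω * (G ω - (P[G | m]) ω) ∂P = 0 := by
    simp only [mul_sub]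
    rw [integral_sub (hFm.integrable_fun_mul hG) (hFm.integrable_fun_mul hGm),
      integral_condExp_mul hm hF hG, sub_self]
  simp only [sub_mul]
  rw [integral_sub (hF.integrable_fun_mul (hG.fun_sub hGm))
    (hFm.integrable_fun_mul (hG.fun_sub hGm)), h0, sub_zero]
  simp only [mul_sub]
  rw [integral_sub (hF.integrable_fun_mul hG) (hF.integrable_fun_mul hGm)]

lemma integral_sub_condExp_sq_le (hm : m ≤ m0) {F : Ω → ℝ} (hF : MemLp F 2 P) :
    ∫ ω, (F ω - (P[F | m]) ω) ^ 2 ∂P ≤ ∫ ω, F ω ^ 2 ∂P := by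
  simp only [sq]
  rw [integral_sub_condExp_mul_sub_condExp hm hF hF]
  have : ∫ ω, F ω * (P[F | m]) ω ∂P = ∫ ω, (P[F | m]) ω * (P[F | m]) ω ∂P := by
    rw [← integral_condExp_mul hm hF hF]; simp only [mul_comm]
  rw [this]
  have : 0 ≤ ∫ ω, (P[F | m]) ω * (P[F | m]) ω ∂P :=
    integral_nonneg fun ω => mul_self_nonneg _
  linarith

end SquareIntegrable

/-! ### The `σ`-fields generated by subfamilies of coordinates -/

section Coordinates

lemma resample_eq_mixOn {Ω : Type*} {E : ℕ → Type*} {X X' : Ω → ∀ n, E n} (k : ℕ) (ω : Ω) :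
    resample X X' k ω = mixOn {k} (X' ω) (X ω) :=
  (mixOn_singleton k _ _).symm

variable {Ω : Type*} {E : ℕ → Type*} [∀ n, MeasurableSpace (E n)] {X : Ω → ∀ n, E n}

lemma sigmaCoord_mono {A B : Set ℕ} (h : A ⊆ B) : sigmaCoord X A ≤ sigmaCoord X B :=
  biSup_mono fun _ hj => h hj

lemma sigmaCoord_eq_comap_mixOn (A : Set ℕ) (e : ∀ n, E n) :
    sigmaCoord X A = MeasurableSpace.comap (fun ω => mixOn A (X ω) e) MeasurableSpace.pi := by
  refine le_antisymm (iSup₂_le fun j hj => ?_) ?_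
  · have h : (fun ω => X ω j) = (fun x : ∀ n, E n => x j) ∘ fun ω => mixOn A (X ω) e := by
      ext ω; simp [mixOn_of_mem hj]
    rw [h, ← MeasurableSpace.comap_comp]
    exact MeasurableSpace.comap_mono (measurable_pi_apply j).comap_le
  · let _ := sigmaCoord X A
    refine measurable_iff_comap_le.1 (measurable_pi_iff.2 fun i => ?_)
    by_cases hi : i ∈ A
    · simp only [mixOn_of_mem hi]
      exact measurable_iff_comap_le.2 (le_iSup₂ (f := fun j (_ : j ∈ A) =>
        MeasurableSpace.comap (fun ω => X ω j) inferInstance) i hi)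
    · simp only [mixOn_of_notMem hi]
      exact measurable_const

lemma sigmaCoord_univ : sigmaCoord X Set.univ = MeasurableSpace.comap X MeasurableSpace.pi := by
  refine le_antisymm (iSup₂_le fun j _ => ?_) ?_
  · rw [show (fun ω => X ω j) = (fun x : ∀ n, E n => x j) ∘ X from rfl,
      ← MeasurableSpace.comap_comp]
    exact MeasurableSpace.comap_mono (measurable_pi_apply j).comap_le
  · let _ := sigmaCoord X Set.univ
    exact measurable_iff_comap_le.1 (measurable_pi_iff.2 fun i =>
      measurable_iff_comap_le.2 (le_iSup₂ (f := fun j (_ : j ∈ Set.univ) =>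
        MeasurableSpace.comap (fun ω => X ω j) inferInstance) i (Set.mem_univ i)))

lemma measurable_sigmaCoord_univ : Measurable[sigmaCoord X Set.univ] X := by
  rw [sigmaCoord_univ]; exact comap_measurable X

variable [m0 : MeasurableSpace Ω]

lemma sigmaCoord_le (hX : Measurable X) (A : Set ℕ) : sigmaCoord X A ≤ m0 :=
  iSup₂_le fun j _ => (measurable_pi_iff.1 hX j).comap_le

lemma gradCoord_congr {P : Measure Ω} {F G : Ω → ℝ} (k : ℕ) (h : F =ᵐ[P] G) :
    gradCoord P X k F =ᵐ[P] gradCoord P X k G :=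
  h.sub (condExp_congr_ae h)

lemma gradCoord_sub {P : Measure Ω} {F G : Ω → ℝ} (k : ℕ) (hF : Integrable F P)
    (hG : Integrable G P) :
    gradCoord P X k (fun ω => F ω - G ω) =ᵐ[P] fun ω => gradCoord P X k F ω - gradCoord P X k G ω := by
  filter_upwards [condExp_sub hF hG (sigmaCoord X {k}ᶜ)] with ω hω
  have : (P[fun ω => F ω - G ω | sigmaCoord X {k}ᶜ]) ω = _ := hω
  simp only [gradCoord, this, Pi.sub_apply]
  ring

variable {P : Measure Ω}

lemma memLp_gradCoord {F : Ω → ℝ} (k : ℕ) (hF : MemLp F 2 P) : MemLp (gradCoord P X k F) 2 P :=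
  hF.sub (hF.condExp one_le_two)

lemma measurable_gradCoord {F : Ω → ℝ} (k : ℕ) (hF : Measurable[sigmaCoord X Set.univ] F) :
    Measurable[sigmaCoord X Set.univ] (gradCoord P X k F) :=
  hF.sub (stronglyMeasurable_condExp.measurable.mono (sigmaCoord_mono (Set.subset_univ _)) le_rfl)

variable [IsProbabilityMeasure P]

lemma lintegral_gradCoord_sq_le (hX : Measurable X) {F : Ω → ℝ} (k : ℕ) (hF : MemLp F 2 P) :
    ∫⁻ ω, ‖gradCoord P X k F ω‖ₑ ^ 2 ∂P ≤ ∫⁻ ω, ‖F ω‖ₑ ^ 2 ∂P := by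
  rw [lintegral_enorm_sq_eq_ofReal hF, lintegral_enorm_sq_eq_ofReal (memLp_gradCoord k hF)]
  exact ENNReal.ofReal_le_ofReal (integral_sub_condExp_sq_le (sigmaCoord_le hX _) hF)

lemma gradCoord_eq_zero_of_measurable (hX : Measurable X) {F : Ω → ℝ} {n k : ℕ} (hnk : n ≤ k)
    (hF : Measurable[sigmaCoord X (Set.Iio n)] F) (hFi : Integrable F P) :
    gradCoord P X k F = 0 := by
  have h : Measurable[sigmaCoord X {k}ᶜ] F := by
    refine hF.mono (sigmaCoord_mono fun i hi => ?_) le_rfl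
    have : i < n := hi
    simp; omega
  ext ω
  simp [gradCoord, condExp_of_stronglyMeasurable (sigmaCoord_le hX _) h.stronglyMeasurable hFi]

end Coordinates

/-! ### Resampling one coordinate -/

section Resample

variable {Ω : Type*} [m0 : MeasurableSpace Ω] {E : ℕ → Type*} [∀ n, MeasurableSpace (E n)]
  {X X' : Ω → ∀ n, E n} {P : Measure Ω}
  {μ : ∀ n, Measure (E n)} [∀ n, IsProbabilityMeasure (μ n)]

lemma measurePreserving_left
    (h : MeasurePreserving (fun ω => (X ω, X' ω)) P
      ((Measure.infinitePi μ).prod (Measure.infinitePi μ))) :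
    MeasurePreserving X P (Measure.infinitePi μ) :=
  measurePreserving_fst.comp h

lemma measurePreserving_resample
    (h : MeasurePreserving (fun ω => (X ω, X' ω)) P
      ((Measure.infinitePi μ).prod (Measure.infinitePi μ))) (k : ℕ) :
    MeasurePreserving (resample X X' k) P (Measure.infinitePi μ) := by
  have := (measurePreserving_mixOn μ {k}).comp h
  rwa [show (fun z : (∀ n, E n) × (∀ n, E n) => mixOn {k} z.2 z.1) ∘ (fun ω => (X ω, X' ω))
    = resample X X' k from funext fun ω => (resample_eq_mixOn k ω).symm] at this

lemma integral_resample_swap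
    (h : MeasurePreserving (fun ω => (X ω, X' ω)) P
      ((Measure.infinitePi μ).prod (Measure.infinitePi μ))) (k : ℕ)
    {Ψ : (∀ n, E n) × (∀ n, E n) → ℝ} (hΨ : Measurable Ψ) :
    ∫ ω, Ψ (X ω, resample X X' k ω) ∂P = ∫ ω, Ψ (resample X X' k ω, X ω) ∂P := by
  have hm : Measurable fun z : (∀ n, E n) × (∀ n, E n) => mixOn {k} z.2 z.1 :=
    Measurable.mixOn _ measurable_snd measurable_fst
  have h1 := integral_map (μ := P) h.measurable.aemeasurable
    (f := fun z => Ψ (z.1, mixOn {k} z.2 z.1))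
    (hΨ.comp (measurable_fst.prodMk hm)).aestronglyMeasurable
  have h2 := integral_map (μ := P) h.measurable.aemeasurable
    (f := fun z => Ψ (mixOn {k} z.2 z.1, z.1))
    (hΨ.comp (hm.prodMk measurable_fst)).aestronglyMeasurable
  rw [h.map_eq] at h1 h2
  simp only [resample_eq_mixOn]
  rw [← h1, ← h2, ← integral_comp_swapOn μ {k} (Ψ := fun z => Ψ (z.1, mixOn {k} z.2 z.1))
    (hΨ.comp (measurable_fst.prodMk hm))]
  refine integral_congr_ae (ae_of_all _ fun z => ?_)
  simp only [swapOn]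
  congr 2
  ext i
  simp only [mixOn, Set.mem_singleton_iff]
  split_ifs <;> rfl

variable [IsProbabilityMeasure P]

lemma measurable_integral_mixOn (k : ℕ) {f : (∀ n, E n) → ℝ} (hfm : Measurable f) :
    Measurable fun x => ∫ y, f (mixOn {k} y x) ∂Measure.infinitePi μ :=
  (StronglyMeasurable.integral_prod_right (f := fun x y => f (mixOn {k} y x))
    (hfm.comp (Measurable.mixOn _ measurable_snd measurable_fst)).stronglyMeasurable).measurable

lemma condExp_comp_eq_integral_resample
    (h : MeasurePreserving (fun ω => (X ω, X' ω)) P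
      ((Measure.infinitePi μ).prod (Measure.infinitePi μ))) (k : ℕ)
    {f : (∀ n, E n) → ℝ} (hfm : Measurable f) (hf : Integrable f (Measure.infinitePi μ)) :
    (fun ω => ∫ y, f (mixOn {k} y (X ω)) ∂Measure.infinitePi μ)
      =ᵐ[P] P[fun ω => f (X ω) | sigmaCoord X {k}ᶜ] := by
  set M := Measure.infinitePi μ
  have hX : MeasurePreserving X P M := measurePreserving_left h
  obtain ⟨ω0⟩ : Nonempty Ω := by
    by_contra hne
    rw [not_nonempty_iff] at hne
    have := measure_univ (μ := P)
    rw [Set.univ_eq_empty_iff.2 hne, measure_empty] at this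
    exact zero_ne_one this
  set e := X ω0
  set fb : (∀ n, E n) → ℝ := fun x => ∫ y, f (mixOn {k} y x) ∂M with hfb
  have hmix : Measurable fun z : (∀ n, E n) × (∀ n, E n) => mixOn {k} z.2 z.1 :=
    Measurable.mixOn _ measurable_snd measurable_fst
  have hfbm : Measurable fb := measurable_integral_mixOn k hfm
  have hint : Integrable (fun z : (∀ n, E n) × (∀ n, E n) => f (mixOn {k} z.2 z.1)) (M.prod M) :=
    (measurePreserving_mixOn μ {k}).integrable_comp_of_integrable hf
  have hfbi : Integrable fb M := hint.integral_prod_left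
  have hfbX : Integrable (fun ω => fb (X ω)) P := hX.integrable_comp_of_integrable hfbi
  have hinv : ∀ x, fb x = fb (mixOn {k}ᶜ x e) := fun x => by
    simp only [hfb]
    congr 1; ext y; congr 1; ext i
    simp only [mixOn, Set.mem_singleton_iff, Set.mem_compl_iff]
    split_ifs <;> rfl
  have hsig := sigmaCoord_eq_comap_mixOn (X := X) {k}ᶜ e
  refine ae_eq_condExp_of_forall_setIntegral_eq (sigmaCoord_le hX.measurable _)
    (hX.integrable_comp_of_integrable hf) (fun s _ _ => hfbX.integrableOn) (fun s hs _ => ?_) ?_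
  · have hs0 : MeasurableSet s := sigmaCoord_le hX.measurable _ s hs
    rw [hsig] at hs
    obtain ⟨B, hB, rfl⟩ := hs
    set J : (∀ n, E n) → ℝ := fun x => B.indicator 1 (mixOn {k}ᶜ x e) with hJ
    have hJm : Measurable J := (measurable_one.indicator hB).comp
      (Measurable.mixOn _ measurable_id measurable_const)
    have hJb : ∀ x, ‖J x‖ ≤ 1 := fun x => by
      classical
      simp only [hJ, Set.indicator_apply]; split_ifs <;> simp
    have hset : ∀ g : (∀ n, E n) → ℝ, Measurable g →
        ∫ ω in (fun ω => mixOn {k}ᶜ (X ω) e) ⁻¹' B, g (X ω) ∂P = ∫ x, J x * g x ∂M := by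
      intro g hg
      rw [← integral_indicator hs0]
      have := integral_map (μ := P) hX.measurable.aemeasurable (f := fun x => J x * g x)
        (hJm.mul hg).aestronglyMeasurable
      rw [hX.map_eq] at this
      rw [this]
      refine integral_congr_ae (ae_of_all _ fun ω => ?_)
      classical
      simp only [hJ, Set.indicator_apply, Set.mem_preimage, Pi.one_apply]
      split_ifs <;> simp
    rw [hset fb hfbm, hset f hfm]
    have h1 : ∫ x, J x * fb x ∂M = ∫ z, J z.1 * f (mixOn {k} z.2 z.1) ∂M.prod M := by
      rw [integral_prod]
      · simp only [hfb, integral_const_mul]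
      · exact hint.bdd_mul (hJm.comp measurable_fst).aestronglyMeasurable
          (ae_of_all _ fun z => hJb z.1)
    have hp : MeasurePreserving Prod.fst (M.prod M) M := measurePreserving_fst
    have h2 : ∫ x, J x * f x ∂M = ∫ z, J z.1 * f z.1 ∂M.prod M := by
      have := integral_map (μ := M.prod M) hp.measurable.aemeasurable (f := fun x => J x * f x)
        (hJm.mul hfm).aestronglyMeasurable
      rwa [hp.map_eq] at this
    rw [h1, h2, ← integral_comp_swapOn μ {k} (Ψ := fun z => J z.1 * f z.1)
      ((hJm.comp measurable_fst).mul (hfm.comp measurable_fst))]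
    refine integral_congr_ae (ae_of_all _ fun z => ?_)
    have hz : mixOn {k}ᶜ (mixOn {k} z.2 z.1) e = mixOn {k}ᶜ z.1 e := by
      ext i
      simp only [mixOn, Set.mem_singleton_iff, Set.mem_compl_iff]
      split_ifs <;> rfl
    simp only [hJ, swapOn, hz]
  · have hc : Measurable[sigmaCoord X {k}ᶜ] fun ω => fb (X ω) := by
      have h3 : (fun ω => fb (X ω)) = fb ∘ fun ω => mixOn {k}ᶜ (X ω) e := by
        ext ω; exact hinv _
      rw [h3, hsig]
      exact hfbm.comp (comap_measurable _)
    exact hc.stronglyMeasurable.aestronglyMeasurable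

/-- The covariance of the discrete gradients in terms of the exchangeable pair `(X, X^{(k)})`. -/
theorem integral_gradCoord_mul_gradCoord
    (h : MeasurePreserving (fun ω => (X ω, X' ω)) P
      ((Measure.infinitePi μ).prod (Measure.infinitePi μ))) (k : ℕ)
    {f g : (∀ n, E n) → ℝ} (hfm : Measurable f) (hf : MemLp f 2 (Measure.infinitePi μ))
    (hgm : Measurable g) (hg : MemLp g 2 (Measure.infinitePi μ)) :
    ∫ ω, gradCoord P X k (fun ω => f (X ω)) ω * gradCoord P X k (fun ω => g (X ω)) ω ∂P =
      (1 / 2) * ∫ ω, (f (resample X X' k ω) - f (X ω)) * (g (resample X X' k ω) - g (X ω)) ∂P := by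
  set M := Measure.infinitePi μ
  have hX : MeasurePreserving X P M := measurePreserving_left h
  have hXk : MeasurePreserving (resample X X' k) P M := measurePreserving_resample h k
  have fX : MemLp (fun ω => f (X ω)) 2 P := hf.comp_measurePreserving hX
  have gX : MemLp (fun ω => g (X ω)) 2 P := hg.comp_measurePreserving hX
  have fk : MemLp (fun ω => f (resample X X' k ω)) 2 P := hf.comp_measurePreserving hXk
  have gk : MemLp (fun ω => g (resample X X' k ω)) 2 P := hg.comp_measurePreserving hXk
  have hmix : Measurable fun z : (∀ n, E n) × (∀ n, E n) => mixOn {k} z.2 z.1 :=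
    Measurable.mixOn _ measurable_snd measurable_fst
  have e1 : ∫ ω, f (X ω) * (P[fun ω => g (X ω) | sigmaCoord X {k}ᶜ]) ω ∂P
      = ∫ ω, f (X ω) * g (resample X X' k ω) ∂P := by
    have h1 : ∫ ω, f (X ω) * (P[fun ω => g (X ω) | sigmaCoord X {k}ᶜ]) ω ∂P
        = ∫ ω, f (X ω) * ∫ y, g (mixOn {k} y (X ω)) ∂M ∂P := by
      refine integral_congr_ae ?_
      filter_upwards [condExp_comp_eq_integral_resample h k hgm (hg.integrable one_le_two)]
        with ω hω
      rw [← hω]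
    have h2 := integral_map (μ := P) hX.measurable.aemeasurable
      (f := fun x => f x * ∫ y, g (mixOn {k} y x) ∂M)
      (hfm.mul (measurable_integral_mixOn k hgm)).aestronglyMeasurable
    have h3 := integral_map (μ := P) h.measurable.aemeasurable
      (f := fun z => f z.1 * g (mixOn {k} z.2 z.1))
      ((hfm.comp measurable_fst).mul (hgm.comp hmix)).aestronglyMeasurable
    rw [hX.map_eq] at h2
    rw [h.map_eq] at h3
    rw [h1, ← h2]
    simp only [resample_eq_mixOn]
    rw [← h3, integral_prod]
    · simp only [integral_const_mul]
    · exact (hf.comp_measurePreserving measurePreserving_fst).integrable_fun_mul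
        (hg.comp_measurePreserving (measurePreserving_mixOn μ {k}))
  have e2 : ∫ ω, f (X ω) * g (resample X X' k ω) ∂P = ∫ ω, f (resample X X' k ω) * g (X ω) ∂P :=
    integral_resample_swap h k (Ψ := fun z => f z.1 * g z.2)
      ((hfm.comp measurable_fst).mul (hgm.comp measurable_snd))
  have e3 : ∫ ω, f (X ω) * g (X ω) ∂P
      = ∫ ω, f (resample X X' k ω) * g (resample X X' k ω) ∂P :=
    integral_resample_swap h k (Ψ := fun z => f z.1 * g z.1)
      ((hfm.comp measurable_fst).mul (hgm.comp measurable_fst))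
  have e4 : ∫ ω, (f (resample X X' k ω) - f (X ω)) * (g (resample X X' k ω) - g (X ω)) ∂P
      = (∫ ω, f (resample X X' k ω) * g (resample X X' k ω) ∂P
        - ∫ ω, f (resample X X' k ω) * g (X ω) ∂P)
        - (∫ ω, f (X ω) * g (resample X X' k ω) ∂P - ∫ ω, f (X ω) * g (X ω) ∂P) := by
    simp only [sub_mul, mul_sub]
    have i1 : Integrable (fun ω => f (resample X X' k ω) * g (resample X X' k ω)
        - f (X ω) * g (resample X X' k ω)) P :=
      (fk.integrable_fun_mul gk).sub (fX.integrable_fun_mul gk)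
    have i2 : Integrable (fun ω => f (resample X X' k ω) * g (X ω) - f (X ω) * g (X ω)) P :=
      (fk.integrable_fun_mul gX).sub (fX.integrable_fun_mul gX)
    rw [integral_sub i1 i2,
      integral_sub (fk.integrable_fun_mul gk) (fX.integrable_fun_mul gk),
      integral_sub (fk.integrable_fun_mul gX) (fX.integrable_fun_mul gX)]
    ring
  simp only [gradCoord]
  rw [integral_sub_condExp_mul_sub_condExp (sigmaCoord_le hX.measurable _) fX gX, e1, e4, ← e3,
    ← e2]
  ring

end Resample

/-! ### The Malliavin derivative -/

lemma tendsto_tsum_zero_of_le_add {t u : ℕ → ℕ → ℝ≥0∞} {v : ℕ → ℝ≥0∞} (hv : ∑' k, v k ≠ ∞)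
    (hle : ∀ n k, t n k ≤ u n k + v k) (ht : ∀ k, Tendsto (fun n => t n k) atTop (𝓝 0))
    (hu : Tendsto (fun n => ∑' k, u n k) atTop (𝓝 0)) :
    Tendsto (fun n => ∑' k, t n k) atTop (𝓝 0) := by
  have h1 : Tendsto (fun n => ∑' k, min (t n k) (v k)) atTop (𝓝 0) := by
    have := tendsto_lintegral_of_dominated_convergence (μ := Measure.count)
      (F := fun n k => min (t n k) (v k)) (f := fun _ => 0) v (fun n => measurable_from_nat)
      (fun n => ae_of_all _ fun k => min_le_right _ _) (by rwa [lintegral_count])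
      (ae_of_all _ fun k => tendsto_of_tendsto_of_tendsto_of_le_of_le tendsto_const_nhds (ht k)
        (fun n => zero_le) fun n => min_le_left _ _)
    simpa [lintegral_count] using this
  have h2 : Tendsto (fun n => ∑' k, u n k + ∑' k, min (t n k) (v k)) atTop (𝓝 0) := by
    simpa using hu.add h1
  refine tendsto_of_tendsto_of_tendsto_of_le_of_le tendsto_const_nhds h2 (fun n => zero_le)
    fun n => ?_
  simp only
  rw [← ENNReal.tsum_add]
  refine ENNReal.tsum_le_tsum fun k => ?_
  rcases le_total (t n k) (v k) with h | h
  · rw [min_eq_left h]; exact le_add_self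
  · rw [min_eq_right h]; exact hle n k

section Malliavin

variable {Ω : Type*} [m0 : MeasurableSpace Ω] {E : ℕ → Type*} [∀ n, MeasurableSpace (E n)]
  {X X' : Ω → ∀ n, E n} {P : Measure Ω}

lemma lintegral_enorm_sq_sub_comm (a b : Ω → ℝ) :
    ∫⁻ ω, ‖a ω - b ω‖ₑ ^ 2 ∂P = ∫⁻ ω, ‖b ω - a ω‖ₑ ^ 2 ∂P := by
  refine lintegral_congr fun ω => ?_
  rw [← enorm_neg, neg_sub]

lemma ae_eq_of_lintegral_enorm_sq_sub_eq_zero {a b : Ω → ℝ} (ha : AEStronglyMeasurable a P)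
    (hb : AEStronglyMeasurable b P) (h : ∫⁻ ω, ‖a ω - b ω‖ₑ ^ 2 ∂P = 0) : a =ᵐ[P] b := by
  have hm : AEStronglyMeasurable (fun ω => a ω - b ω) P := ha.sub hb
  rw [lintegral_eq_zero_iff' (hm.enorm.pow_const 2)] at h
  filter_upwards [h] with ω hω
  simpa [sub_eq_zero] using hω

lemma MemL2Process.memLp {V : ℕ → Ω → ℝ} (hX : Measurable X) (hV : MemL2Process P X V) (k : ℕ) :
    MemLp (V k) 2 P :=
  memLp_two_of_lintegral_lt_top
    ((hV.measurable k).mono (sigmaCoord_le hX _) le_rfl).aestronglyMeasurable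
    ((ENNReal.le_tsum k).trans_lt hV.sq_summable)

lemma lintegral_comp_sub_sq_le {φ : ℝ → ℝ} {C : ℝ} (hφ : ∀ x y, |φ x - φ y| ≤ C * |x - y|)
    (F G : Ω → ℝ) :
    ∫⁻ ω, ‖φ (F ω) - φ (G ω)‖ₑ ^ 2 ∂P ≤ ENNReal.ofReal C ^ 2 * ∫⁻ ω, ‖F ω - G ω‖ₑ ^ 2 ∂P := by
  rw [← lintegral_const_mul' _ _ (by simp)]
  refine lintegral_mono fun ω => ?_
  rw [← mul_pow]
  gcongr
  rw [← ofReal_norm, ← ofReal_norm, ← ENNReal.ofReal_mul' (norm_nonneg _)]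
  exact ENNReal.ofReal_le_ofReal (hφ _ _)

lemma MemL2X.exists_representative {μ : ∀ n, Measure (E n)} [∀ n, IsProbabilityMeasure (μ n)]
    (h : MeasurePreserving (fun ω => (X ω, X' ω)) P
      ((Measure.infinitePi μ).prod (Measure.infinitePi μ))) {F : Ω → ℝ} (hF : MemL2X P X F) :
    ∃ f : (∀ n, E n) → ℝ, Measurable f ∧ MemLp f 2 (Measure.infinitePi μ) ∧
      F = fun ω => f (X ω) := by
  have hX := measurePreserving_left h
  have hm := hF.measurable
  rw [sigmaCoord_univ] at hm
  obtain ⟨f, hf, rfl⟩ := hm.exists_eq_measurable_comp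
  refine ⟨f, hf, ?_, rfl⟩
  have := hF.memLp
  rwa [← memLp_map_measure_iff hf.aestronglyMeasurable hX.measurable.aemeasurable, hX.map_eq]
    at this

variable [IsProbabilityMeasure P]

lemma lintegral_gradCoord_sub_sq_le (hX : Measurable X) {F G : Ω → ℝ} (k : ℕ) (hF : MemLp F 2 P)
    (hG : MemLp G 2 P) :
    ∫⁻ ω, ‖gradCoord P X k F ω - gradCoord P X k G ω‖ₑ ^ 2 ∂P ≤ ∫⁻ ω, ‖F ω - G ω‖ₑ ^ 2 ∂P := by
  refine le_trans (le_of_eq (lintegral_congr_ae ?_)) (lintegral_gradCoord_sq_le hX k (hF.fun_sub hG))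
  filter_upwards [gradCoord_sub (X := X) k (hF.integrable one_le_two) (hG.integrable one_le_two)]
    with ω hω
  rw [hω]

/-- The Malliavin derivative is given by the discrete gradient. -/
theorem IsMalliavinDeriv.ae_eq_gradCoord (hX : Measurable X) {F : Ω → ℝ} {V : ℕ → Ω → ℝ}
    (h : IsMalliavinDeriv P X F V) (k : ℕ) : V k =ᵐ[P] gradCoord P X k F := by
  obtain ⟨S, hS, hSF, hSV⟩ := h.exists_approx
  have hF := h.memL2X.memLp
  have hV := (IsMalliavinDeriv.memL2Process h).memLp hX k
  have hD := memLp_gradCoord (X := X) k hF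
  refine (ae_eq_of_lintegral_enorm_sq_sub_eq_zero hD.1 hV.1 ?_).symm
  have hlim : Tendsto (fun n => 2 * ∫⁻ ω, ‖S n ω - F ω‖ₑ ^ 2 ∂P
      + 2 * ∑' k, ∫⁻ ω, ‖gradCoord P X k (S n) ω - V k ω‖ₑ ^ 2 ∂P) atTop (𝓝 0) := by
    simpa using (ENNReal.Tendsto.const_mul hSF (Or.inr (by norm_num))).add
      (ENNReal.Tendsto.const_mul hSV (Or.inr (by norm_num)))
  refine le_antisymm (ge_of_tendsto' hlim fun n => ?_) zero_le
  have hDS := memLp_gradCoord (X := X) k (hS n).memLp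
  refine (lintegral_enorm_sq_sub_le (c := gradCoord P X k (S n)) (hD.fun_sub hDS).1).trans ?_
  refine add_le_add (mul_le_mul_right ?_ 2) (mul_le_mul_right ?_ 2)
  · rw [lintegral_enorm_sq_sub_comm]
    exact lintegral_gradCoord_sub_sq_le hX k (hS n).memLp hF
  · exact ENNReal.le_tsum (f := fun k => ∫⁻ ω, ‖gradCoord P X k (S n) ω - V k ω‖ₑ ^ 2 ∂P) k

lemma memLp_comp_of_abs_sub_le {F : Ω → ℝ} (hF : MemLp F 2 P) {φ : ℝ → ℝ} {C : ℝ}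
    (hφ : ∀ x y, |φ x - φ y| ≤ C * |x - y|) (hφc : Continuous φ) :
    MemLp (fun ω => φ (F ω)) 2 P := by
  have habs : MemLp (fun ω => |F ω|) 2 P := hF.norm
  have h : MemLp (fun ω => |φ 0| + C * |F ω|) 2 P :=
    (memLp_const |φ 0|).add (habs.const_mul C)
  refine h.mono (hφc.comp_aestronglyMeasurable hF.1) (ae_of_all _ fun ω => ?_)
  have h1 := hφ (F ω) 0
  have h2 := abs_add_le (φ (F ω) - φ 0) (φ 0)
  rw [sub_add_cancel] at h2
  rw [sub_zero] at h1
  rw [Real.norm_eq_abs, Real.norm_eq_abs]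
  exact le_trans (by linarith) (le_abs_self _)

variable {μ : ∀ n, Measure (E n)} [∀ n, IsProbabilityMeasure (μ n)]

lemma lintegral_gradCoord_eq
    (h : MeasurePreserving (fun ω => (X ω, X' ω)) P
      ((Measure.infinitePi μ).prod (Measure.infinitePi μ))) (k : ℕ)
    {f : (∀ n, E n) → ℝ} (hfm : Measurable f) (hf : MemLp f 2 (Measure.infinitePi μ)) :
    ∫⁻ ω, ‖gradCoord P X k (fun ω => f (X ω)) ω‖ₑ ^ 2 ∂P =
      ENNReal.ofReal ((1 / 2) * ∫ ω, (f (resample X X' k ω) - f (X ω)) ^ 2 ∂P) := by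
  have hX := measurePreserving_left h
  have hfX : MemLp (fun ω => f (X ω)) 2 P := hf.comp_measurePreserving hX
  rw [lintegral_enorm_sq_eq_ofReal (memLp_gradCoord k hfX)]
  simp only [sq]
  exact congrArg _ (integral_gradCoord_mul_gradCoord h k hfm hf hfm hf)

/-- Lipschitz functions contract the discrete gradient. -/
lemma lintegral_gradCoord_comp_sq_le
    (h : MeasurePreserving (fun ω => (X ω, X' ω)) P
      ((Measure.infinitePi μ).prod (Measure.infinitePi μ))) (k : ℕ) {F : Ω → ℝ}
    (hF : MemL2X P X F) {φ : ℝ → ℝ} {C : ℝ} (hφ : ∀ x y, |φ x - φ y| ≤ C * |x - y|)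
    (hφc : Continuous φ) :
    ∫⁻ ω, ‖gradCoord P X k (fun ω => φ (F ω)) ω‖ₑ ^ 2 ∂P
      ≤ ENNReal.ofReal C ^ 2 * ∫⁻ ω, ‖gradCoord P X k F ω‖ₑ ^ 2 ∂P := by
  have hC : 0 ≤ C := by
    have := (abs_nonneg _).trans (hφ 1 0)
    simpa using this
  obtain ⟨f, hfm, hf, rfl⟩ := hF.exists_representative h
  have hX := measurePreserving_left h
  have hXk := measurePreserving_resample h k
  have hφf : MemLp (fun x => φ (f x)) 2 (Measure.infinitePi μ) :=
    memLp_comp_of_abs_sub_le hf hφ hφc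
  rw [lintegral_gradCoord_eq h k hfm hf,
    lintegral_gradCoord_eq h k (f := fun x => φ (f x)) (hφc.measurable.comp hfm) hφf,
    ← ENNReal.ofReal_pow hC, ← ENNReal.ofReal_mul (by positivity)]
  refine ENNReal.ofReal_le_ofReal ?_
  rw [mul_left_comm]
  refine mul_le_mul_of_nonneg_left ?_ (by norm_num)
  rw [← integral_const_mul]
  refine integral_mono_of_nonneg (ae_of_all _ fun ω => sq_nonneg _)
    ((((hf.comp_measurePreserving hXk).sub (hf.comp_measurePreserving hX)).integrable_sq).const_mul _)
    (ae_of_all _ fun ω => ?_)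
  have := hφ (f (resample X X' k ω)) (f (X ω))
  calc _ = |φ (f (resample X X' k ω)) - φ (f (X ω))| ^ 2 := (sq_abs _).symm
    _ ≤ (C * |f (resample X X' k ω) - f (X ω)|) ^ 2 := by gcongr
    _ = _ := by rw [mul_pow, sq_abs]

/-- The domain of the Malliavin derivative is stable under Lipschitz functions. -/
theorem IsMalliavinDeriv.comp_lipschitz
    (h : MeasurePreserving (fun ω => (X ω, X' ω)) P
      ((Measure.infinitePi μ).prod (Measure.infinitePi μ))) {F : Ω → ℝ} {V : ℕ → Ω → ℝ}
    (hF : IsMalliavinDeriv P X F V) {φ : ℝ → ℝ} {C : ℝ} (hφ : ∀ x y, |φ x - φ y| ≤ C * |x - y|)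
    (hφc : Continuous φ) :
    IsMalliavinDeriv P X (fun ω => φ (F ω)) fun k => gradCoord P X k (fun ω => φ (F ω)) := by
  have hX := (measurePreserving_left h).measurable
  set K : ℝ≥0∞ := ENNReal.ofReal C ^ 2 with hK
  have hKtop : K ≠ ∞ := by simp [hK]
  have hFm := hF.memL2X
  have hφm : MemL2X P X fun ω => φ (F ω) :=
    ⟨hφc.measurable.comp hFm.measurable, memLp_comp_of_abs_sub_le hFm.memLp hφ hφc⟩
  have hDF : ∑' k, ∫⁻ ω, ‖gradCoord P X k F ω‖ₑ ^ 2 ∂P ≠ ∞ := by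
    have : ∀ k, ∫⁻ ω, ‖gradCoord P X k F ω‖ₑ ^ 2 ∂P = ∫⁻ ω, ‖V k ω‖ₑ ^ 2 ∂P := fun k => by
      refine lintegral_congr_ae ?_
      filter_upwards [hF.ae_eq_gradCoord hX k] with ω hω
      rw [hω]
    simp only [this]
    exact hF.memL2Process.sq_summable.ne
  obtain ⟨S, hS, hSF, hSV⟩ := hF.exists_approx
  have hSm : ∀ n, MemL2X P X (S n) := fun n => by
    obtain ⟨j, hj⟩ := (hS n).measurable
    exact ⟨hj.mono (sigmaCoord_mono (Set.subset_univ _)) le_rfl, (hS n).memLp⟩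
  have hφS : ∀ n, MemLp (fun ω => φ (S n ω)) 2 P := fun n =>
    memLp_comp_of_abs_sub_le (hS n).memLp hφ hφc
  have hconv : Tendsto (fun n => ∫⁻ ω, ‖φ (S n ω) - φ (F ω)‖ₑ ^ 2 ∂P) atTop (𝓝 0) := by
    refine tendsto_of_tendsto_of_tendsto_of_le_of_le tendsto_const_nhds
      (h := fun n => K * ∫⁻ ω, ‖S n ω - F ω‖ₑ ^ 2 ∂P) ?_ (fun n => zero_le)
      fun n => lintegral_comp_sub_sq_le hφ _ _
    simpa using ENNReal.Tendsto.const_mul hSF (Or.inr hKtop)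
  refine ⟨hφm, ⟨fun k => measurable_gradCoord k hφm.measurable, ?_⟩,
    fun n ω => φ (S n ω), fun n => ?_, hconv, ?_⟩
  · refine (ENNReal.tsum_le_tsum fun k => lintegral_gradCoord_comp_sq_le h k hFm hφ hφc).trans_lt ?_
    rw [ENNReal.tsum_mul_left]
    exact ENNReal.mul_lt_top hKtop.lt_top hDF.lt_top
  · obtain ⟨j, hj⟩ := (hS n).measurable
    exact ⟨⟨j, hφc.measurable.comp hj⟩, hφS n⟩
  · refine tendsto_tsum_zero_of_le_add
      (u := fun n k => 4 * K * ∫⁻ ω, ‖gradCoord P X k (S n) ω - V k ω‖ₑ ^ 2 ∂P)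
      (v := fun k => 6 * K * ∫⁻ ω, ‖gradCoord P X k F ω‖ₑ ^ 2 ∂P) ?_ (fun n k => ?_)
      (fun k => ?_) ?_
    · rw [ENNReal.tsum_mul_left]
      exact ENNReal.mul_ne_top (ENNReal.mul_ne_top (by norm_num) hKtop) hDF
    · have a1 := lintegral_enorm_sq_sub_le (P := P) (a := gradCoord P X k fun ω => φ (S n ω))
        (b := gradCoord P X k fun ω => φ (F ω)) (c := fun _ => 0)
        (by simpa using (memLp_gradCoord k (hφS n)).1)
      have a2 := lintegral_enorm_sq_sub_le (P := P) (a := gradCoord P X k (S n))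
        (b := fun _ => 0) (c := V k)
        (((memLp_gradCoord k (hS n).memLp)).fun_sub (hF.memL2Process.memLp hX k)).1
      have a3 : ∫⁻ ω, ‖V k ω‖ₑ ^ 2 ∂P = ∫⁻ ω, ‖gradCoord P X k F ω‖ₑ ^ 2 ∂P := by
        refine lintegral_congr_ae ?_
        filter_upwards [hF.ae_eq_gradCoord hX k] with ω hω
        rw [hω]
      have a4 := lintegral_gradCoord_comp_sq_le h k (hSm n) hφ hφc
      have a5 := lintegral_gradCoord_comp_sq_le h k hFm hφ hφc
      simp only [sub_zero, zero_sub, enorm_neg] at a1 a2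
      rw [a3] at a2
      calc _ ≤ _ := a1
        _ ≤ 2 * (K * (2 * ∫⁻ ω, ‖gradCoord P X k (S n) ω - V k ω‖ₑ ^ 2 ∂P
              + 2 * ∫⁻ ω, ‖gradCoord P X k F ω‖ₑ ^ 2 ∂P))
            + 2 * (K * ∫⁻ ω, ‖gradCoord P X k F ω‖ₑ ^ 2 ∂P) := by
          gcongr
          exact a4.trans (by gcongr)
        _ = _ := by ring
    · exact tendsto_of_tendsto_of_tendsto_of_le_of_le tendsto_const_nhds hconv (fun n => zero_le)
        fun n => lintegral_gradCoord_sub_sq_le hX k (hφS n) hφm.memLp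
    · simp only [ENNReal.tsum_mul_left]
      simpa using ENNReal.Tendsto.const_mul hSV
        (Or.inr (ENNReal.mul_ne_top (by norm_num) hKtop))

/-- **Poincaré inequality** for cylindrical random variables. -/
theorem IsCylindrical.poincare
    (h : MeasurePreserving (fun ω => (X ω, X' ω)) P
      ((Measure.infinitePi μ).prod (Measure.infinitePi μ))) {S : Ω → ℝ}
    (hS : IsCylindrical P X S) (hS0 : ∫ ω, S ω ∂P = 0) :
    ∫⁻ ω, ‖S ω‖ₑ ^ 2 ∂P ≤ ∑' k, ∫⁻ ω, ‖gradCoord P X k S ω‖ₑ ^ 2 ∂P := by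
  have hX := measurePreserving_left h
  obtain ⟨n, hn⟩ := hS.measurable
  obtain ⟨ω0⟩ : Nonempty Ω := P.nonempty_of_neZero
  rw [sigmaCoord_eq_comap_mixOn _ (X ω0)] at hn
  obtain ⟨f0, hf0, hSf⟩ := hn.exists_eq_measurable_comp
  set f : (∀ n, E n) → ℝ := fun x => f0 (mixOn (Set.Iio n) x (X ω0)) with hf
  have hfm : Measurable f := hf0.comp (Measurable.mixOn _ measurable_id measurable_const)
  have hSf' : S = fun ω => f (X ω) := hSf
  have hfL : MemLp f 2 (Measure.infinitePi μ) := by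
    have := hS.memLp
    rw [hSf'] at this
    rwa [← hX.map_eq, memLp_map_measure_iff hfm.aestronglyMeasurable hX.measurable.aemeasurable]
  have hdep : DependsOn f (Set.Iio n) := fun x y hxy => by
    simp only [hf]
    congr 1
    ext i
    by_cases hi : i ∈ Set.Iio n
    · rw [mixOn_of_mem hi, mixOn_of_mem hi, hxy i hi]
    · rw [mixOn_of_notMem hi, mixOn_of_notMem hi]
  have hes := efron_stein_of_dependsOn μ hfm hfL n hdep
  have hmean : ∫ x, f x ∂Measure.infinitePi μ = 0 := by
    rw [← hX.map_eq, integral_map hX.measurable.aemeasurable hfm.aestronglyMeasurable, ← hS0, hSf']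
  have hsq : ∫ x, f x ^ 2 ∂Measure.infinitePi μ = ∫ ω, S ω ^ 2 ∂P := by
    rw [← hX.map_eq, integral_map hX.measurable.aemeasurable (hfm.pow_const 2).aestronglyMeasurable,
      hSf']
  have hmix : ∀ k, Measurable fun z : (∀ n, E n) × (∀ n, E n) => mixOn {k} z.2 z.1 := fun k =>
    Measurable.mixOn _ measurable_snd measurable_fst
  have hterm : ∀ k, ∫ z, (f (mixOn {k} z.2 z.1) - f z.1) ^ 2
        ∂(Measure.infinitePi μ).prod (Measure.infinitePi μ)
      = ∫ ω, (f (resample X X' k ω) - f (X ω)) ^ 2 ∂P := fun k => by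
    have := integral_map (μ := P) h.measurable.aemeasurable
      (f := fun z => (f (mixOn {k} z.2 z.1) - f z.1) ^ 2)
      (((hfm.comp (hmix k)).sub (hfm.comp measurable_fst)).pow_const 2).aestronglyMeasurable
    rw [h.map_eq] at this
    simp only [resample_eq_mixOn]
    exact this
  simp only [hmean, hsq, hterm, ne_eq, OfNat.ofNat_ne_zero, not_false_eq_true, zero_pow,
    sub_zero] at hes
  calc _ = ENNReal.ofReal (∫ ω, S ω ^ 2 ∂P) := lintegral_enorm_sq_eq_ofReal hS.memLp
    _ ≤ ENNReal.ofReal (∑ k ∈ Finset.range n,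
          (1 / 2) * ∫ ω, (f (resample X X' k ω) - f (X ω)) ^ 2 ∂P) := ENNReal.ofReal_le_ofReal hes
    _ = ∑ k ∈ Finset.range n, ∫⁻ ω, ‖gradCoord P X k S ω‖ₑ ^ 2 ∂P := by
      rw [ENNReal.ofReal_sum_of_nonneg fun k _ =>
        mul_nonneg (by norm_num) (integral_nonneg fun ω => sq_nonneg _)]
      refine Finset.sum_congr rfl fun k _ => ?_
      rw [hSf', lintegral_gradCoord_eq h k hfm hfL]
    _ ≤ _ := ENNReal.sum_le_tsum _

end Malliavin

/-! ### Existence of the pseudo-inverse of the Ornstein–Uhlenbeck generator -/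

/-- Lax–Milgram for the graph closure of an operator that satisfies a Poincaré inequality. -/
theorem exists_mem_topologicalClosure_inner_snd_eq {H K : Type*} [NormedAddCommGroup H]
    [InnerProductSpace ℝ H] [CompleteSpace H] [NormedAddCommGroup K] [InnerProductSpace ℝ K]
    [CompleteSpace K] (T : Submodule ℝ (WithLp 2 (H × K))) (hT : ∀ w ∈ T, ‖w.fst‖ ≤ ‖w.snd‖)
    (l : H) : ∃ g ∈ T.topologicalClosure, ∀ w ∈ T.topologicalClosure,
      inner ℝ g.snd w.snd = inner ℝ l w.fst := by
  set C := T.topologicalClosure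
  have hfst : Continuous fun w : WithLp 2 (H × K) => w.fst := (WithLp.fstL 2 ℝ H K).continuous
  have hsnd : Continuous fun w : WithLp 2 (H × K) => w.snd := (WithLp.sndL 2 ℝ H K).continuous
  have hC : ∀ w ∈ C, ‖w.fst‖ ≤ ‖w.snd‖ := fun w hw =>
    closure_minimal (s := (T : Set (WithLp 2 (H × K)))) (t := {w | ‖w.fst‖ ≤ ‖w.snd‖}) hT
      (isClosed_le hfst.norm hsnd.norm) hw
  have : CompleteSpace C := T.isClosed_topologicalClosure.completeSpace_coe
  have hnorm : ∀ w : WithLp 2 (H × K), ‖w.snd‖ ≤ ‖w‖ := fun w => by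
    refine abs_le_of_sq_le_sq' ?_ (norm_nonneg _) |>.2
    rw [WithLp.prod_norm_sq_eq_of_L2]
    nlinarith [sq_nonneg ‖w.fst‖]
  let B : C →L[ℝ] C →L[ℝ] ℝ := LinearMap.mkContinuous₂
    (LinearMap.mk₂ ℝ (fun u v : C => (inner ℝ (u : WithLp 2 (H × K)).snd (v : WithLp 2 (H × K)).snd : ℝ))
      (fun u u' v => inner_add_left _ _ _) (fun c u v => real_inner_smul_left _ _ _)
      (fun u v v' => inner_add_right _ _ _) (fun c u v => real_inner_smul_right _ _ _)) 1
    (fun u v => by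
      rw [one_mul]
      exact (norm_inner_le_norm _ _).trans
        (mul_le_mul (hnorm _) (hnorm _) (norm_nonneg _) (norm_nonneg _)))
  have hB : IsCoercive B := by
    refine ⟨1 / 2, by norm_num, fun u => ?_⟩
    have h1 : B u u = ‖(u : WithLp 2 (H × K)).snd‖ ^ 2 := real_inner_self_eq_norm_sq _
    have h2 := WithLp.prod_norm_sq_eq_of_L2 (u : WithLp 2 (H × K))
    have h3 := hC u u.2
    have h4 : ‖u‖ = ‖(u : WithLp 2 (H × K))‖ := rfl
    rw [h1, h4]
    nlinarith [norm_nonneg (u : WithLp 2 (H × K)).fst]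
  let ℓ : C →L[ℝ] ℝ := (innerSL ℝ l).comp ((WithLp.fstL 2 ℝ H K).comp C.subtypeL)
  set z := (InnerProductSpace.toDual ℝ C).symm ℓ
  set g := hB.continuousLinearEquivOfBilin.symm z
  refine ⟨g, g.2, fun w hw => ?_⟩
  have h1 := hB.continuousLinearEquivOfBilin_apply g ⟨w, hw⟩
  rw [ContinuousLinearEquiv.apply_symm_apply, InnerProductSpace.toDual_symm_apply] at h1
  exact h1.symm

section SquareIntegrableProcesses

variable {Ω : Type*} [m0 : MeasurableSpace Ω] {P : Measure Ω}

lemma lintegral_enorm_sq_eq_enorm_sq (u : Lp ℝ 2 P) : ∫⁻ ω, ‖u ω‖ₑ ^ 2 ∂P = ‖u‖ₑ ^ 2 := by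
  rw [Lp.enorm_def, eLpNorm_eq_lintegral_rpow_enorm_toReal (by norm_num) (by norm_num),
    ← ENNReal.rpow_natCast, ← ENNReal.rpow_mul]
  simp

lemma lintegral_enorm_sq_sub_eq_enorm_sq {u v : Lp ℝ 2 P} {a b : Ω → ℝ} (ha : u =ᵐ[P] a)
    (hb : v =ᵐ[P] b) : ∫⁻ ω, ‖a ω - b ω‖ₑ ^ 2 ∂P = ‖u - v‖ₑ ^ 2 := by
  rw [← lintegral_enorm_sq_eq_enorm_sq]
  refine lintegral_congr_ae ?_
  filter_upwards [ha, hb, Lp.coeFn_sub u v] with ω h1 h2 h3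
  rw [h3, Pi.sub_apply, h1, h2]

lemma tsum_enorm_sq_eq_enorm_sq (w : lp (fun _ : ℕ => Lp ℝ 2 P) 2) :
    ∑' k, ‖w k‖ₑ ^ 2 = ‖w‖ₑ ^ 2 := by
  have h := lp.hasSum_norm (by norm_num) w
  simp only [ENNReal.toReal_ofNat, Real.rpow_two] at h
  have e : ∀ x : Lp ℝ 2 P, ‖x‖ₑ ^ 2 = ENNReal.ofReal (‖x‖ ^ 2) := fun x => by
    rw [ENNReal.ofReal_pow (norm_nonneg _), ofReal_norm]
  simp only [e]
  rw [← ENNReal.ofReal_tsum_of_nonneg (fun k => sq_nonneg _) h.summable, h.tsum_eq,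
    ENNReal.ofReal_pow (norm_nonneg _), ofReal_norm]

lemma memℓp_two_of_tsum_enorm_sq_lt_top {w : ℕ → Lp ℝ 2 P} (h : ∑' k, ‖w k‖ₑ ^ 2 < ∞) :
    Memℓp w 2 := by
  refine memℓp_gen ?_
  simp only [ENNReal.toReal_ofNat, Real.rpow_two]
  have := ENNReal.summable_toReal h.ne
  simpa using this

lemma tendsto_enorm_sq_zero_iff {G : Type*} [NormedAddCommGroup G] {u : ℕ → G} {v : G} :
    Tendsto (fun n => ‖u n - v‖ₑ ^ 2) atTop (𝓝 0) ↔ Tendsto u atTop (𝓝 v) := by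
  rw [tendsto_iff_norm_sub_tendsto_zero]
  constructor
  · intro h
    have h1 := (ENNReal.tendsto_toReal (by simp)).comp h
    have h2 := h1.sqrt
    simpa [Function.comp_def, Real.sqrt_sq (norm_nonneg _)] using h2
  · intro h
    have h1 := ENNReal.tendsto_ofReal (h.pow 2)
    simpa [ENNReal.ofReal_pow (norm_nonneg _), ofReal_norm] using h1

end SquareIntegrableProcesses

section PseudoInverse

variable {Ω : Type*} [m0 : MeasurableSpace Ω] {E : ℕ → Type*} [∀ n, MeasurableSpace (E n)]
  {X X' : Ω → ∀ n, E n} {P : Measure Ω} [IsProbabilityMeasure P]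

/-- The discrete gradient as a bounded operator on `L²`. -/
noncomputable def gradCLM (P : Measure Ω) (hX : Measurable X) (k : ℕ) :
    Lp ℝ 2 P →L[ℝ] Lp ℝ 2 P :=
  ContinuousLinearMap.id ℝ _ -
    (lpMeas ℝ ℝ (sigmaCoord X {k}ᶜ) 2 P).subtypeL.comp (condExpL2 ℝ ℝ (sigmaCoord_le hX {k}ᶜ))

lemma gradCLM_ae_eq (hX : Measurable X) (k : ℕ) {u : Lp ℝ 2 P} {F : Ω → ℝ} (h : u =ᵐ[P] F) :
    gradCLM P hX k u =ᵐ[P] gradCoord P X k F := by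
  have hu : MemLp u 2 P := Lp.memLp u
  have h1 := hu.condExpL2_ae_eq_condExp (𝕜 := ℝ) (sigmaCoord_le hX {k}ᶜ)
  rw [Lp.toLp_coeFn] at h1
  have h2 := Lp.coeFn_sub u ((condExpL2 ℝ ℝ (sigmaCoord_le hX {k}ᶜ) u : lpMeas ℝ ℝ _ 2 P) : Lp ℝ 2 P)
  refine EventuallyEq.trans h2 ?_
  filter_upwards [h, h1, condExp_congr_ae (m := sigmaCoord X {k}ᶜ) h] with ω a1 a2 a3
  rw [Pi.sub_apply, a1, a2, a3]
  rfl

/-- The classes of the centered cylindrical random variables. -/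
def centeredCylindrical (P : Measure Ω) [IsProbabilityMeasure P] (X : Ω → ∀ n, E n) :
    Submodule ℝ (Lp ℝ 2 P) where
  carrier := {u | ∃ S, IsCylindrical P X S ∧ ∫ ω, S ω ∂P = 0 ∧ u =ᵐ[P] S}
  add_mem' := by
    rintro u v ⟨S, hS, hS0, hu⟩ ⟨S', hS', hS0', hv⟩
    obtain ⟨n, hn⟩ := hS.measurable
    obtain ⟨n', hn'⟩ := hS'.measurable
    have h1 : Measurable[sigmaCoord X (Set.Iio (max n n'))] S :=
      hn.mono (sigmaCoord_mono (Set.Iio_subset_Iio (le_max_left _ _))) le_rfl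
    have h2 : Measurable[sigmaCoord X (Set.Iio (max n n'))] S' :=
      hn'.mono (sigmaCoord_mono (Set.Iio_subset_Iio (le_max_right _ _))) le_rfl
    refine ⟨fun ω => S ω + S' ω, ⟨⟨_, h1.add h2⟩, hS.memLp.add hS'.memLp⟩, ?_, ?_⟩
    · rw [integral_add (hS.memLp.integrable one_le_two)
        (hS'.memLp.integrable one_le_two), hS0, hS0', add_zero]
    · filter_upwards [hu, hv, Lp.coeFn_add u v] with ω a1 a2 a3
      rw [a3, Pi.add_apply, a1, a2]
  zero_mem' := ⟨fun _ => 0, ⟨⟨0, measurable_const⟩, MemLp.zero'⟩, by simp, Lp.coeFn_zero _ _ _⟩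
  smul_mem' := by
    rintro c u ⟨S, hS, hS0, hu⟩
    obtain ⟨n, hn⟩ := hS.measurable
    refine ⟨fun ω => c * S ω, ⟨⟨n, hn.const_mul c⟩, hS.memLp.const_mul c⟩, ?_, ?_⟩
    · rw [integral_const_mul, hS0, mul_zero]
    · filter_upwards [hu, Lp.coeFn_smul c u] with ω a1 a2
      rw [a2, Pi.smul_apply, a1, smul_eq_mul]

/-- The graph of the discrete gradient on the centered cylindrical random variables. -/
noncomputable def gradGraph (P : Measure Ω) [IsProbabilityMeasure P] (hX : Measurable X) :
    Submodule ℝ (WithLp 2 (Lp ℝ 2 P × lp (fun _ : ℕ => Lp ℝ 2 P) 2)) where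
  carrier := {w | w.fst ∈ centeredCylindrical P X ∧ ∀ k, w.snd k = gradCLM P hX k w.fst}
  add_mem' := fun {u v} hu hv => ⟨Submodule.add_mem _ hu.1 hv.1, fun k => by
    rw [WithLp.add_snd, WithLp.add_fst, map_add, ← hu.2, ← hv.2]; rfl⟩
  zero_mem' := ⟨Submodule.zero_mem _, fun k => by
    rw [WithLp.zero_snd, WithLp.zero_fst, map_zero]; rfl⟩
  smul_mem' := fun c u hu => ⟨Submodule.smul_mem _ c hu.1, fun k => by
    rw [WithLp.smul_snd, WithLp.smul_fst, map_smul, ← hu.2]; rfl⟩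

lemma IsCylindrical.sub_const {S : Ω → ℝ} (hS : IsCylindrical P X S) (c : ℝ) :
    IsCylindrical P X fun ω => S ω - c := by
  obtain ⟨n, hn⟩ := hS.measurable
  exact ⟨⟨n, hn.sub_const c⟩, hS.memLp.fun_sub (memLp_const c)⟩

lemma IsCylindrical.tsum_lintegral_gradCoord_lt_top (hX : Measurable X) {S : Ω → ℝ}
    (hS : IsCylindrical P X S) : ∑' k, ∫⁻ ω, ‖gradCoord P X k S ω‖ₑ ^ 2 ∂P < ∞ := by
  obtain ⟨n, hn⟩ := hS.measurable
  rw [tsum_eq_sum (s := Finset.range n) fun k hk => by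
    rw [gradCoord_eq_zero_of_measurable hX (not_lt.1 (by simpa using hk)) hn
      (hS.memLp.integrable one_le_two)]
    simp]
  refine ENNReal.sum_lt_top.2 fun k _ => ?_
  rw [lintegral_enorm_sq_eq_ofReal (memLp_gradCoord k hS.memLp)]
  exact ENNReal.ofReal_lt_top

lemma gradCoord_sub_const (hX : Measurable X) {F : Ω → ℝ} (hF : Integrable F P) (c : ℝ) (k : ℕ) :
    gradCoord P X k (fun ω => F ω - c) =ᵐ[P] gradCoord P X k F := by
  filter_upwards [gradCoord_sub (X := X) k hF (integrable_const c)] with ω hω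
  rw [hω]
  simp [gradCoord, condExp_const (sigmaCoord_le hX {k}ᶜ)]

lemma lintegral_enorm_sq_sub_integral_le {Y : Ω → ℝ} (hY : MemLp Y 2 P) :
    ∫⁻ ω, ‖Y ω - ∫ ω, Y ω ∂P‖ₑ ^ 2 ∂P ≤ ∫⁻ ω, ‖Y ω‖ₑ ^ 2 ∂P := by
  rw [lintegral_enorm_sq_eq_ofReal hY,
    lintegral_enorm_sq_eq_ofReal (hY.fun_sub (memLp_const _))]
  refine ENNReal.ofReal_le_ofReal ?_
  have := integral_sub_condExp_sq_le (m := ⊥) bot_le hY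
  simpa only [condExp_bot] using this

variable {μ : ∀ n, Measure (E n)} [∀ n, IsProbabilityMeasure (μ n)]

lemma norm_fst_le_norm_snd_of_mem_gradGraph
    (h : MeasurePreserving (fun ω => (X ω, X' ω)) P
      ((Measure.infinitePi μ).prod (Measure.infinitePi μ))) (hX : Measurable X)
    {w : WithLp 2 (Lp ℝ 2 P × lp (fun _ : ℕ => Lp ℝ 2 P) 2)} (hw : w ∈ gradGraph P hX) :
    ‖w.fst‖ ≤ ‖w.snd‖ := by
  obtain ⟨⟨S, hS, hS0, hwS⟩, hw2⟩ := hw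
  have h1 := hS.poincare h hS0
  have h2 : ∀ k, ∫⁻ ω, ‖gradCoord P X k S ω‖ₑ ^ 2 ∂P = ‖w.snd k‖ₑ ^ 2 := fun k => by
    rw [hw2, ← lintegral_enorm_sq_eq_enorm_sq]
    refine lintegral_congr_ae ?_
    filter_upwards [gradCLM_ae_eq hX k hwS] with ω hω
    rw [hω]
  have h3 : ∫⁻ ω, ‖S ω‖ₑ ^ 2 ∂P = ‖w.fst‖ₑ ^ 2 := by
    rw [← lintegral_enorm_sq_eq_enorm_sq]
    refine lintegral_congr_ae ?_
    filter_upwards [hwS] with ω hω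
    rw [hω]
  simp only [h2, h3, tsum_enorm_sq_eq_enorm_sq] at h1
  have h4 := (ENNReal.pow_le_pow_left_iff two_ne_zero).1 h1
  rwa [← ofReal_norm, ← ofReal_norm, ENNReal.ofReal_le_ofReal_iff (norm_nonneg _)] at h4

lemma IsMalliavinDeriv.mem_topologicalClosure_gradGraph (hX : Measurable X) {F : Ω → ℝ}
    {V : ℕ → Ω → ℝ} (hF : IsMalliavinDeriv P X F V)
    {w : WithLp 2 (Lp ℝ 2 P × lp (fun _ : ℕ => Lp ℝ 2 P) 2)}
    (hw1 : w.fst =ᵐ[P] fun ω => F ω - ∫ ω, F ω ∂P) (hw2 : ∀ k, w.snd k =ᵐ[P] V k) :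
    w ∈ (gradGraph P hX).topologicalClosure := by
  obtain ⟨S, hS, hSF, hSV⟩ := hF.exists_approx
  let S' : ℕ → Ω → ℝ := fun n ω => S n ω - ∫ ω, S n ω ∂P
  have hS' : ∀ n, IsCylindrical P X (S' n) := fun n => (hS n).sub_const _
  have hSi : ∀ n, Integrable (S n) P := fun n => (hS n).memLp.integrable one_le_two
  have hS'0 : ∀ n, ∫ ω, S' n ω ∂P = 0 := fun n => by
    simp only [S']
    rw [integral_sub (hSi n) (integrable_const _)]
    simp
  let u : ℕ → Lp ℝ 2 P := fun n => (hS' n).memLp.toLp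
  have hu : ∀ n, u n =ᵐ[P] S' n := fun n => MemLp.coeFn_toLp _
  have hgu : ∀ n k, gradCLM P hX k (u n) =ᵐ[P] gradCoord P X k (S n) := fun n k =>
    (gradCLM_ae_eq hX k (hu n)).trans (gradCoord_sub_const hX (hSi n) _ k)
  have hmem : ∀ n, Memℓp (fun k => gradCLM P hX k (u n)) 2 := fun n => by
    refine memℓp_two_of_tsum_enorm_sq_lt_top ?_
    have : ∀ k, ‖gradCLM P hX k (u n)‖ₑ ^ 2 = ∫⁻ ω, ‖gradCoord P X k (S n) ω‖ₑ ^ 2 ∂P := fun k => by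
      rw [← lintegral_enorm_sq_eq_enorm_sq]
      refine lintegral_congr_ae ?_
      filter_upwards [hgu n k] with ω hω
      rw [hω]
    simp only [this]
    exact (hS n).tsum_lintegral_gradCoord_lt_top hX
  let v : ℕ → lp (fun _ : ℕ => Lp ℝ 2 P) 2 := fun n => ⟨fun k => gradCLM P hX k (u n), hmem n⟩
  have hv : ∀ n k, v n k = gradCLM P hX k (u n) := fun n k => rfl
  refine mem_closure_iff_seq_limit.2 ⟨fun n => WithLp.toLp 2 (u n, v n), fun n =>
    ⟨⟨S' n, hS' n, hS'0 n, hu n⟩, fun k => rfl⟩, ?_⟩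
  have h1 : Tendsto u atTop (𝓝 w.fst) := by
    rw [← tendsto_enorm_sq_zero_iff]
    refine tendsto_of_tendsto_of_tendsto_of_le_of_le tendsto_const_nhds hSF (fun n => zero_le)
      fun n => ?_
    have hY : MemLp (fun ω => S n ω - F ω) 2 P := (hS n).memLp.fun_sub hF.memL2X.memLp
    refine le_trans (le_of_eq ?_) (lintegral_enorm_sq_sub_integral_le hY)
    rw [← lintegral_enorm_sq_sub_eq_enorm_sq (hu n) hw1,
      integral_sub (hSi n) (hF.memL2X.memLp.integrable one_le_two)]
    refine lintegral_congr fun ω => ?_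
    simp only [S']
    congr 2
    ring
  have h2 : Tendsto v atTop (𝓝 w.snd) := by
    rw [← tendsto_enorm_sq_zero_iff]
    refine hSV.congr fun n => ?_
    rw [← tsum_enorm_sq_eq_enorm_sq]
    refine tsum_congr fun k => ?_
    exact lintegral_enorm_sq_sub_eq_enorm_sq (hgu n k) (hw2 k)
  exact ((WithLp.prod_continuous_toLp 2 _ _).tendsto _).comp (h1.prodMk_nhds h2)

/-- The Ornstein–Uhlenbeck generator is onto the centered elements of `L²_X`. -/
theorem exists_isOUPreimage
    (h : MeasurePreserving (fun ω => (X ω, X' ω)) P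
      ((Measure.infinitePi μ).prod (Measure.infinitePi μ))) {F : Ω → ℝ} (hF : MemL2X P X F)
    (hF0 : ∫ ω, F ω ∂P = 0) : ∃ G, IsOUPreimage P X F G := by
  have hX := (measurePreserving_left h).measurable
  have hle := sigmaCoord_le hX Set.univ
  obtain ⟨g, hg, hgw⟩ := exists_mem_topologicalClosure_inner_snd_eq (gradGraph P hX)
    (fun w hw => norm_fst_le_norm_snd_of_mem_gradGraph h hX hw) (-hF.memLp.toLp)
  obtain ⟨w, hwT, hwg⟩ := mem_closure_iff_seq_limit.1 hg
  have hw1 : Tendsto (fun n => (w n).fst) atTop (𝓝 g.fst) :=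
    ((WithLp.fstL 2 ℝ _ _).continuous.tendsto g).comp hwg
  have hw2 : Tendsto (fun n => (w n).snd) atTop (𝓝 g.snd) :=
    ((WithLp.sndL 2 ℝ _ _).continuous.tendsto g).comp hwg
  choose S hS hS0 hwS using fun n => (hwT n).1
  have hmeas : AEStronglyMeasurable[sigmaCoord X Set.univ] g.fst P := by
    refine (isClosed_aestronglyMeasurable (p := 2) (F := ℝ) (μ := P) hle).mem_of_tendsto hw1
      (Eventually.of_forall fun n => ?_)
    obtain ⟨j, hj⟩ := (hS n).measurable
    exact ⟨S n, (hj.mono (sigmaCoord_mono (Set.subset_univ _)) le_rfl).stronglyMeasurable, hwS n⟩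
  obtain ⟨G, hGm, hGg⟩ := hmeas
  have hGL : MemLp G 2 P := (memLp_congr_ae hGg).1 (Lp.memLp _)
  have hG : MemL2X P X G := ⟨hGm.measurable, hGL⟩
  have hgrad : ∀ k, g.snd k =ᵐ[P] gradCoord P X k G := fun k => by
    have e1 : Tendsto (fun n => (w n).snd k) atTop (𝓝 (g.snd k)) :=
      ((lp.evalCLM ℝ (fun _ : ℕ => Lp ℝ 2 P) 2 k).continuous.tendsto _).comp hw2
    have e2 : Tendsto (fun n => gradCLM P hX k (w n).fst) atTop (𝓝 (gradCLM P hX k g.fst)) :=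
      ((gradCLM P hX k).continuous.tendsto _).comp hw1
    have e3 : g.snd k = gradCLM P hX k g.fst := by
      refine tendsto_nhds_unique e1 (e2.congr fun n => ((hwT n).2 k).symm)
    rw [e3]
    exact gradCLM_ae_eq hX k hGg
  have hproc : MemL2Process P X fun k => gradCoord P X k G := by
    refine ⟨fun k => measurable_gradCoord k hG.measurable, ?_⟩
    have : ∀ k, ∫⁻ ω, ‖gradCoord P X k G ω‖ₑ ^ 2 ∂P = ‖g.snd k‖ₑ ^ 2 := fun k => by
      rw [← lintegral_enorm_sq_eq_enorm_sq]
      refine lintegral_congr_ae ?_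
      filter_upwards [hgrad k] with ω hω
      rw [hω]
    simp only [this, tsum_enorm_sq_eq_enorm_sq]
    simp
  have hderiv : IsMalliavinDeriv P X G fun k => gradCoord P X k G := by
    refine ⟨hG, hproc, S, hS, ?_, ?_⟩
    · refine (tendsto_enorm_sq_zero_iff.2 hw1).congr fun n => ?_
      exact (lintegral_enorm_sq_sub_eq_enorm_sq (hwS n) hGg).symm
    · refine (tendsto_enorm_sq_zero_iff.2 hw2).congr fun n => ?_
      rw [← tsum_enorm_sq_eq_enorm_sq]
      refine tsum_congr fun k => ?_
      refine (lintegral_enorm_sq_sub_eq_enorm_sq ?_ (hgrad k)).symm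
      rw [(hwT n).2 k]
      exact gradCLM_ae_eq hX k (hwS n)
  refine ⟨G, ⟨_, hderiv, hproc, ⟨hF.measurable.neg, hF.memLp.neg⟩, fun F' V' hF' => ?_⟩, ?_⟩
  · have hF'L := hF'.memL2X.memLp
    have hV'L := hF'.memL2Process.memLp hX
    let u : Lp ℝ 2 P := (hF'L.fun_sub (memLp_const (∫ ω, F' ω ∂P))).toLp
    let v : ℕ → Lp ℝ 2 P := fun k => (hV'L k).toLp
    have hv : ∀ k, v k =ᵐ[P] V' k := fun k => MemLp.coeFn_toLp _
    have hvm : Memℓp v 2 := by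
      refine memℓp_two_of_tsum_enorm_sq_lt_top ?_
      have : ∀ k, ‖v k‖ₑ ^ 2 = ∫⁻ ω, ‖V' k ω‖ₑ ^ 2 ∂P := fun k => by
        rw [← lintegral_enorm_sq_eq_enorm_sq]
        refine lintegral_congr_ae ?_
        filter_upwards [hv k] with ω hω
        rw [hω]
      simp only [this]
      exact hF'.memL2Process.sq_summable
    have hu : u =ᵐ[P] fun ω => F' ω - ∫ ω, F' ω ∂P := MemLp.coeFn_toLp _
    have key := hgw (WithLp.toLp 2 (u, ⟨v, hvm⟩))
      (hF'.mem_topologicalClosure_gradGraph hX hu hv)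
    rw [lp.inner_eq_tsum] at key
    have e1 : ∀ k, ∫ ω, V' k ω * gradCoord P X k G ω ∂P = inner ℝ (g.snd k) (v k) := fun k => by
      rw [L2.inner_def]
      refine integral_congr_ae ?_
      filter_upwards [hgrad k, hv k] with ω a1 a2
      rw [a1, a2]
      simp
    simp only [e1]
    refine key.trans ?_
    rw [L2.inner_def]
    have e2 : ∫ ω, F' ω * -F ω ∂P = ∫ ω, (F' ω - ∫ ω, F' ω ∂P) * -F ω ∂P := by
      have hnF : MemLp (fun ω => -F ω) 2 P := hF.memLp.neg
      simp only [sub_mul]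
      rw [integral_sub (hF'L.integrable_fun_mul hnF)
        ((memLp_const _).integrable_fun_mul hnF), integral_const_mul]
      simp [integral_neg, hF0]
    rw [e2]
    refine integral_congr_ae ?_
    filter_upwards [hu, Lp.coeFn_neg (hF.memLp.toLp), hF.memLp.coeFn_toLp] with ω a1 a2 a3
    rw [a2, Pi.neg_apply, a3]
    change inner ℝ (-F ω) (u ω) = _
    rw [a1]
    simp
  · have hclosed : IsClosed {u : Lp ℝ 2 P | ∫ ω, u ω ∂P = 0} := by
      have : (fun u : Lp ℝ 2 P => ∫ ω, u ω ∂P) = fun u => inner ℝ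
          (indicatorConstLp 2 MeasurableSet.univ (measure_ne_top P _) (1 : ℝ)) u := by
        ext u
        rw [L2.inner_indicatorConstLp_one, setIntegral_univ]
      refine isClosed_eq ?_ continuous_const
      rw [this]
      exact continuous_const.inner continuous_id
    have := hclosed.mem_of_tendsto hw1 (Eventually.of_forall fun n => by
      change ∫ ω, (w n).fst ω ∂P = 0
      rw [integral_congr_ae (hwS n), hS0 n])
    rw [← integral_congr_ae hGg]
    exact this

end PseudoInverse

/-! ### Exchangeable increments and the Stein bounds -/

lemma ae_summable_and_integrable_tsum {α : Type*} [MeasurableSpace α] {ν : Measure α}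
    {Y : ℕ → α → ℝ} (hY : ∀ k, Integrable (Y k) ν) (hs : Summable fun k => ∫ a, |Y k a| ∂ν) :
    (∀ᵐ a ∂ν, Summable fun k => Y k a) ∧ Integrable (fun a => ∑' k, Y k a) ν := by
  have hfin : ∫⁻ a, ∑' k, ‖Y k a‖ₑ ∂ν < ∞ := by
    rw [lintegral_tsum fun k => (hY k).1.enorm]
    have : ∀ k, ∫⁻ a, ‖Y k a‖ₑ ∂ν = ENNReal.ofReal (∫ a, |Y k a| ∂ν) := fun k =>
      (ofReal_integral_norm_eq_lintegral_enorm (hY k)).symm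
    simp only [this]
    rw [← ENNReal.ofReal_tsum_of_nonneg (fun k => integral_nonneg fun a => abs_nonneg _) hs]
    exact ENNReal.ofReal_lt_top
  have hsum : ∀ᵐ a ∂ν, Summable fun k => Y k a := by
    have hm : AEMeasurable (fun a => ∑' k, ‖Y k a‖ₑ) ν :=
      AEMeasurable.tsum fun k => (hY k).1.enorm
    filter_upwards [ae_lt_top' hm hfin.ne] with a ha
    have := ENNReal.summable_toReal ha.ne
    simp only [toReal_enorm] at this
    exact this.of_norm
  refine ⟨hsum, ?_, lt_of_le_of_lt (lintegral_mono fun a => ?_) hfin⟩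
  · refine aestronglyMeasurable_of_tendsto_ae atTop
      (f := fun n a => ∑ k ∈ Finset.range n, Y k a)
      (fun n => (integrable_finsetSum _ fun k _ => hY k).1) ?_
    filter_upwards [hsum] with a ha using ha.hasSum.tendsto_sum_nat
  · exact enorm_tsum_le_tsum_enorm

section Increments

variable {Ω : Type*} [m0 : MeasurableSpace Ω] {E : ℕ → Type*} [∀ n, MeasurableSpace (E n)]
  {X X' : Ω → ∀ n, E n} {P : Measure Ω}

/-- The increment `f(X^{(k)}) - f(X)`. -/
def incr (X X' : Ω → ∀ n, E n) (f : (∀ n, E n) → ℝ) (k : ℕ) (ω : Ω) : ℝ :=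
  f (resample X X' k ω) - f (X ω)

variable {μ : ∀ n, Measure (E n)} [∀ n, IsProbabilityMeasure (μ n)]

lemma memLp_incr
    (h : MeasurePreserving (fun ω => (X ω, X' ω)) P
      ((Measure.infinitePi μ).prod (Measure.infinitePi μ))) {f : (∀ n, E n) → ℝ}
    (hf : MemLp f 2 (Measure.infinitePi μ)) (k : ℕ) : MemLp (incr X X' f k) 2 P :=
  (hf.comp_measurePreserving (measurePreserving_resample h k)).sub
    (hf.comp_measurePreserving (measurePreserving_left h))

lemma summable_integral_abs_mul_incr
    (h : MeasurePreserving (fun ω => (X ω, X' ω)) P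
      ((Measure.infinitePi μ).prod (Measure.infinitePi μ))) {f g : (∀ n, E n) → ℝ}
    (hf : MemLp f 2 (Measure.infinitePi μ)) (hg : MemLp g 2 (Measure.infinitePi μ))
    (hfs : Summable fun k => ∫ ω, incr X X' f k ω ^ 2 ∂P)
    (hgs : Summable fun k => ∫ ω, incr X X' g k ω ^ 2 ∂P) :
    Summable fun k => ∫ ω, |incr X X' g k ω| * |incr X X' f k ω| ∂P := by
  refine Summable.of_nonneg_of_le
    (fun k => integral_nonneg fun ω => mul_nonneg (abs_nonneg _) (abs_nonneg _)) (fun k => ?_)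
    (hfs.add hgs)
  have i1 := (memLp_incr h hf k).integrable_sq
  have i2 := (memLp_incr h hg k).integrable_sq
  rw [← integral_add i1 i2]
  refine integral_mono_of_nonneg
    (ae_of_all _ fun ω => mul_nonneg (abs_nonneg _) (abs_nonneg _)) (i1.add i2)
    (ae_of_all _ fun ω => ?_)
  simp only
  nlinarith [sq_nonneg (|incr X X' g k ω| - |incr X X' f k ω|), sq_abs (incr X X' g k ω),
    sq_abs (incr X X' f k ω), sq_nonneg (incr X X' g k ω), sq_nonneg (incr X X' f k ω)]

/-- The terms of the carré-du-champ operator are absolutely summable. -/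
lemma summable_integral_abs_carreDuChampTerm
    (h : MeasurePreserving (fun ω => (X ω, X' ω)) P
      ((Measure.infinitePi μ).prod (Measure.infinitePi μ))) {f g : (∀ n, E n) → ℝ}
    (hf : MemLp f 2 (Measure.infinitePi μ)) (hg : MemLp g 2 (Measure.infinitePi μ))
    (hfs : Summable fun k => ∫ ω, incr X X' f k ω ^ 2 ∂P)
    (hgs : Summable fun k => ∫ ω, incr X X' g k ω ^ 2 ∂P) :
    Summable fun k => ∫ ω, |carreDuChampTerm P X X' f g k ω| ∂P := by
  refine Summable.of_nonneg_of_le (fun k => integral_nonneg fun ω => abs_nonneg _) (fun k => ?_)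
    (summable_integral_abs_mul_incr h hf hg hfs hgs)
  refine (integral_abs_condExp_le _).trans (le_of_eq ?_)
  refine integral_congr_ae (ae_of_all _ fun ω => ?_)
  simp only [abs_mul, incr]
  ring

variable [IsProbabilityMeasure P]

lemma IsMalliavinDeriv.summable_integral_incr_sq
    (h : MeasurePreserving (fun ω => (X ω, X' ω)) P
      ((Measure.infinitePi μ).prod (Measure.infinitePi μ))) {F : Ω → ℝ} {V : ℕ → Ω → ℝ}
    (hF : IsMalliavinDeriv P X F V) {f : (∀ n, E n) → ℝ}
    (hf : IsRepresentative P X (Measure.infinitePi μ) F f) :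
    Summable fun k => ∫ ω, incr X X' f k ω ^ 2 ∂P := by
  have hX := (measurePreserving_left h).measurable
  have e : ∀ k, ∫⁻ ω, ‖V k ω‖ₑ ^ 2 ∂P
      = ENNReal.ofReal ((1 / 2) * ∫ ω, incr X X' f k ω ^ 2 ∂P) := fun k => by
    rw [show (∫ ω, incr X X' f k ω ^ 2 ∂P) = ∫ ω, (f (resample X X' k ω) - f (X ω)) ^ 2 ∂P from rfl,
      ← lintegral_gradCoord_eq h k hf.measurable hf.memLp]
    refine lintegral_congr_ae ?_
    filter_upwards [hF.ae_eq_gradCoord hX k, gradCoord_congr (X := X) k hf.ae_eq] with ω a1 a2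
    rw [a1, a2]
  have hs := hF.memL2Process.sq_summable
  simp only [e] at hs
  have h1 := ENNReal.summable_toReal hs.ne
  have h2 : ∀ k, 0 ≤ (1 / 2 : ℝ) * ∫ ω, incr X X' f k ω ^ 2 ∂P := fun k =>
    mul_nonneg (by norm_num) (integral_nonneg fun ω => sq_nonneg _)
  simp only [ENNReal.toReal_ofReal (h2 _)] at h1
  exact (summable_mul_left_iff (by norm_num)).1 h1

/-- Integration by parts: `E[F φ(F)] = ½ ∑ₖ E[-(g(X^{(k)}) - g(X)) (φ(f(X^{(k)})) - φ(f(X)))]`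
when `g` represents a preimage of `F` under the Ornstein–Uhlenbeck generator. -/
theorem IsOUGenerator.integral_mul_comp
    (h : MeasurePreserving (fun ω => (X ω, X' ω)) P
      ((Measure.infinitePi μ).prod (Measure.infinitePi μ))) {F G : Ω → ℝ} {V : ℕ → Ω → ℝ}
    (hF : IsMalliavinDeriv P X F V) (hG : IsOUGenerator P X G F) {f g : (∀ n, E n) → ℝ}
    (hf : IsRepresentative P X (Measure.infinitePi μ) F f)
    (hg : IsRepresentative P X (Measure.infinitePi μ) G g)
    {φ : ℝ → ℝ} {C : ℝ} (hφ : ∀ x y, |φ x - φ y| ≤ C * |x - y|) (hφc : Continuous φ) :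
    ∫ ω, f (X ω) * φ (f (X ω)) ∂P =
      (1 / 2) * ∑' k, ∫ ω, -incr X X' g k ω * incr X X' (fun x => φ (f x)) k ω ∂P := by
  have hX := (measurePreserving_left h).measurable
  obtain ⟨U, hU, hdiv⟩ := hG
  have key := hdiv.adjoint _ _ (hF.comp_lipschitz h hφ hφc)
  have hφf : MemLp (fun x => φ (f x)) 2 (Measure.infinitePi μ) :=
    memLp_comp_of_abs_sub_le hf.memLp hφ hφc
  have hFae : (fun ω => φ (F ω)) =ᵐ[P] fun ω => φ (f (X ω)) := by
    filter_upwards [hf.ae_eq] with ω hω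
    rw [hω]
  have e1 : ∀ k, ∫ ω, gradCoord P X k (fun ω => φ (F ω)) ω * U k ω ∂P
      = (1 / 2) * ∫ ω, incr X X' (fun x => φ (f x)) k ω * incr X X' g k ω ∂P := fun k => by
    refine Eq.trans (integral_congr_ae ?_) (integral_gradCoord_mul_gradCoord h k
      (hφc.measurable.comp hf.measurable) hφf hg.measurable hg.memLp)
    filter_upwards [gradCoord_congr (X := X) k hFae, hU.ae_eq_gradCoord hX k,
      gradCoord_congr (X := X) k hg.ae_eq] with ω a1 a2 a3
    rw [a1, a2, a3]
    rfl
  have e2 : ∫ ω, f (X ω) * φ (f (X ω)) ∂P = -∫ ω, φ (F ω) * -F ω ∂P := by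
    rw [← integral_neg]
    refine integral_congr_ae ?_
    filter_upwards [hf.ae_eq] with ω hω
    rw [hω]; ring
  rw [e2, ← key]
  simp only [e1]
  rw [tsum_mul_left, ← mul_neg, ← tsum_neg]
  congr 1
  refine tsum_congr fun k => ?_
  rw [← integral_neg]
  exact integral_congr_ae (ae_of_all _ fun ω => by ring)

/-- The Malliavin–Stein bound for a general solution of the Stein equation. -/
theorem abs_integral_stein_le
    (h : MeasurePreserving (fun ω => (X ω, X' ω)) P
      ((Measure.infinitePi μ).prod (Measure.infinitePi μ))) {F G : Ω → ℝ} {V : ℕ → Ω → ℝ}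
    (hF : IsMalliavinDeriv P X F V) (hG : IsOUGenerator P X G F) {f g : (∀ n, E n) → ℝ}
    (hf : IsRepresentative P X (Measure.infinitePi μ) F f)
    (hg : IsRepresentative P X (Measure.infinitePi μ) G g)
    {φ p : ℝ → ℝ} {C B : ℝ} (hφ : ∀ x y, |φ x - φ y| ≤ C * |x - y|) (hφc : Continuous φ)
    (hp : Measurable p) (hpB : ∀ x, |p x| ≤ B) :
    ENNReal.ofReal |∫ ω, (p (F ω) - F ω * φ (F ω)) ∂P| ≤
      ENNReal.ofReal B *
          ∫⁻ ω, ENNReal.ofReal |1 - carreDuChamp P X X' f (fun x => - g x) ω| ∂P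
        + (1 / 2) * ∑' k, ∫⁻ ω, ENNReal.ofReal (|incr X X' g k ω| *
          |φ (f (resample X X' k ω)) - φ (f (X ω)) - p (f (X ω)) * incr X X' f k ω|) ∂P := by
  have hX := measurePreserving_left h
  have hB : 0 ≤ B := (abs_nonneg _).trans (hpB 0)
  have hfs := hF.summable_integral_incr_sq h hf
  obtain ⟨U, hU, hdiv⟩ := id hG
  have hgs := hU.summable_integral_incr_sq h hg
  have hg' : MemLp (fun x => - g x) 2 (Measure.infinitePi μ) := hg.memLp.neg
  have hincr' : ∀ k ω, incr X X' (fun x => - g x) k ω = -incr X X' g k ω := fun k ω => by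
    simp only [incr]; ring
  have hgs' : Summable fun k => ∫ ω, incr X X' (fun x => - g x) k ω ^ 2 ∂P := by
    simpa only [hincr', neg_sq] using hgs
  have hφf : MemLp (fun x => φ (f x)) 2 (Measure.infinitePi μ) :=
    memLp_comp_of_abs_sub_le hf.memLp hφ hφc
  have hfX : MemLp (fun ω => f (X ω)) 2 P := hf.memLp.comp_measurePreserving hX
  have hφfX : MemLp (fun ω => φ (f (X ω))) 2 P := hφf.comp_measurePreserving hX
  set T : ℕ → Ω → ℝ := fun k => carreDuChampTerm P X X' f (fun x => - g x) k with hT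
  have hTs : Summable fun k => ∫ ω, |T k ω| ∂P :=
    summable_integral_abs_carreDuChampTerm h hf.memLp hg' hfs hgs'
  have hTi : ∀ k, Integrable (T k) P := fun k => integrable_condExp
  obtain ⟨hTae, hTsum⟩ := ae_summable_and_integrable_tsum hTi hTs
  set Γ := carreDuChamp P X X' f (fun x => - g x) with hΓ
  have hΓi : Integrable Γ P := hTsum.const_mul (1 / 2)
  have hpm : Measurable fun ω => p (f (X ω)) :=
    hp.comp (hf.measurable.comp hX.measurable)
  have hpb : ∀ᵐ ω ∂P, ‖p (f (X ω))‖ ≤ B := ae_of_all _ fun ω => hpB _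
  have hpi : Integrable (fun ω => p (f (X ω))) P :=
    (integrable_const B).mono' hpm.aestronglyMeasurable hpb
  have hfg : ∀ k, Integrable (fun ω => incr X X' f k ω * -incr X X' g k ω) P := fun k =>
    (memLp_incr h hf.memLp k).integrable_fun_mul (memLp_incr h hg.memLp k).neg
  have hpfg : ∀ k, Integrable (fun ω => p (f (X ω)) * (incr X X' f k ω * -incr X X' g k ω)) P :=
    fun k => (hfg k).bdd_mul hpm.aestronglyMeasurable hpb
  -- the main term
  have hpull : ∀ k, ∫ ω, p (f (X ω)) * T k ω ∂P
      = ∫ ω, p (f (X ω)) * (incr X X' f k ω * -incr X X' g k ω) ∂P := fun k => by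
    have hpσ : Measurable[sigmaCoord X Set.univ] fun ω => p (f (X ω)) :=
      (hp.comp hf.measurable).comp measurable_sigmaCoord_univ
    have hle := sigmaCoord_le hX.measurable Set.univ
    have e : (fun ω => (f (resample X X' k ω) - f (X ω)) *
        (-g (resample X X' k ω) - -g (X ω))) = fun ω => incr X X' f k ω * -incr X X' g k ω := by
      ext ω; simp only [incr]; ring
    have h1 := condExp_mul_of_stronglyMeasurable_left hpσ.stronglyMeasurable (hpfg k) (hfg k)
    have h2 := integral_condExp (μ := P) hle
      (f := fun ω => p (f (X ω)) * (incr X X' f k ω * -incr X X' g k ω))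
    rw [← h2]
    refine integral_congr_ae ?_
    filter_upwards [h1] with ω hω
    rw [show (fun ω => p (f (X ω)) * (incr X X' f k ω * -incr X X' g k ω)) =
      (fun ω => p (f (X ω))) * fun ω => incr X X' f k ω * -incr X X' g k ω from rfl, hω]
    simp only [hT, carreDuChampTerm, e, Pi.mul_apply]
  have hmain : ∫ ω, p (f (X ω)) * Γ ω ∂P
      = (1 / 2) * ∑' k, ∫ ω, p (f (X ω)) * (incr X X' f k ω * -incr X X' g k ω) ∂P := by
    have i1 : ∀ k, Integrable (fun ω => p (f (X ω)) * T k ω) P := fun k =>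
      (hTi k).bdd_mul hpm.aestronglyMeasurable hpb
    have s1 : Summable fun k => ∫ ω, ‖p (f (X ω)) * T k ω‖ ∂P := by
      refine Summable.of_nonneg_of_le (fun k => integral_nonneg fun ω => norm_nonneg _)
        (fun k => ?_) (hTs.mul_left B)
      rw [← integral_const_mul]
      refine integral_mono_of_nonneg (ae_of_all _ fun ω => norm_nonneg _)
        ((hTi k).abs.const_mul B) (ae_of_all _ fun ω => ?_)
      simp only [norm_mul, Real.norm_eq_abs]
      exact mul_le_mul_of_nonneg_right (hpB _) (abs_nonneg _)
    have h1 := (hasSum_integral_of_summable_integral_norm i1 s1).tsum_eq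
    simp only [hpull] at h1
    rw [h1, ← integral_const_mul]
    refine integral_congr_ae (ae_of_all _ fun ω => ?_)
    simp only [hΓ, carreDuChamp, hT, tsum_mul_left]
    ring
  -- the remainder
  set R : ℕ → Ω → ℝ := fun k ω =>
    φ (f (resample X X' k ω)) - φ (f (X ω)) - p (f (X ω)) * incr X X' f k ω with hR
  have hRb : ∀ k ω, |R k ω| ≤ (C + B) * |incr X X' f k ω| := fun k ω => by
    refine (abs_sub _ _).trans ?_
    rw [abs_mul, add_mul]
    exact add_le_add (hφ _ _) (mul_le_mul_of_nonneg_right (hpB _) (abs_nonneg _))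
  have hgφ : ∀ k, Integrable
      (fun ω => -incr X X' g k ω * incr X X' (fun x => φ (f x)) k ω) P := fun k =>
    (memLp_incr h hg.memLp k).neg.integrable_fun_mul (memLp_incr h hφf k)
  have hgR_eq : ∀ k ω, -incr X X' g k ω * R k ω =
      -incr X X' g k ω * incr X X' (fun x => φ (f x)) k ω
        - p (f (X ω)) * (incr X X' f k ω * -incr X X' g k ω) := fun k ω => by
    simp only [hR, incr]; ring
  have hgR : ∀ k, Integrable (fun ω => -incr X X' g k ω * R k ω) P := fun k => by
    simp only [hgR_eq]; exact (hgφ k).sub (hpfg k)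
  have hfgabs := summable_integral_abs_mul_incr h hf.memLp hg.memLp hfs hgs
  have hRs : Summable fun k => ∫ ω, |incr X X' g k ω| * |R k ω| ∂P := by
    refine Summable.of_nonneg_of_le
      (fun k => integral_nonneg fun ω => mul_nonneg (abs_nonneg _) (abs_nonneg _)) (fun k => ?_)
      (hfgabs.mul_left (C + B))
    rw [← integral_const_mul]
    have i1 : Integrable (fun ω => |incr X X' g k ω| * |incr X X' f k ω|) P :=
      (memLp_incr h hg.memLp k).norm.integrable_fun_mul (memLp_incr h hf.memLp k).norm
    refine integral_mono_of_nonneg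
      (ae_of_all _ fun ω => mul_nonneg (abs_nonneg _) (abs_nonneg _)) (i1.const_mul _)
      (ae_of_all _ fun ω => ?_)
    have := mul_le_mul_of_nonneg_left (hRb k ω) (abs_nonneg (incr X X' g k ω))
    simp only
    linarith
  have hgRabs : ∀ k, |∫ ω, -incr X X' g k ω * R k ω ∂P| ≤ ∫ ω, |incr X X' g k ω| * |R k ω| ∂P :=
    fun k => by
      refine (abs_integral_le_integral_abs).trans (le_of_eq ?_)
      simp only [abs_mul, abs_neg]
  have hsumR : Summable fun k => ∫ ω, -incr X X' g k ω * R k ω ∂P :=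
    Summable.of_norm_bounded hRs hgRabs
  have hsump : Summable fun k => ∫ ω, p (f (X ω)) * (incr X X' f k ω * -incr X X' g k ω) ∂P := by
    refine Summable.of_norm_bounded (hfgabs.mul_left B) fun k => ?_
    rw [← integral_const_mul]
    have i1 : Integrable (fun ω => |incr X X' g k ω| * |incr X X' f k ω|) P :=
      (memLp_incr h hg.memLp k).norm.integrable_fun_mul (memLp_incr h hf.memLp k).norm
    refine norm_integral_le_of_norm_le (i1.const_mul B) (ae_of_all _ fun ω => ?_)
    simp only [norm_mul, norm_neg, Real.norm_eq_abs]
    have := mul_le_mul_of_nonneg_right (hpB (f (X ω)))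
      (mul_nonneg (abs_nonneg (incr X X' g k ω)) (abs_nonneg (incr X X' f k ω)))
    linarith
  have hdecomp : ∑' k, ∫ ω, -incr X X' g k ω * incr X X' (fun x => φ (f x)) k ω ∂P
      = ∑' k, ∫ ω, p (f (X ω)) * (incr X X' f k ω * -incr X X' g k ω) ∂P
        + ∑' k, ∫ ω, -incr X X' g k ω * R k ω ∂P := by
    rw [← hsump.tsum_add hsumR]
    refine tsum_congr fun k => ?_
    simp only [hgR_eq]
    rw [integral_sub (hgφ k) (hpfg k)]
    ring
  have hibp := hG.integral_mul_comp h hF hf hg hφ hφc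
  rw [hdecomp, mul_add, ← hmain] at hibp
  have hpΓ : Integrable (fun ω => p (f (X ω)) * Γ ω) P :=
    hΓi.bdd_mul hpm.aestronglyMeasurable hpb
  have hΓ1 : Integrable (fun ω => 1 - Γ ω) P := (integrable_const 1).sub hΓi
  have hid : ∫ ω, (p (F ω) - F ω * φ (F ω)) ∂P = ∫ ω, p (f (X ω)) * (1 - Γ ω) ∂P
      - (1 / 2) * ∑' k, ∫ ω, -incr X X' g k ω * R k ω ∂P := by
    have e1 : ∫ ω, (p (F ω) - F ω * φ (F ω)) ∂P
        = ∫ ω, (p (f (X ω)) - f (X ω) * φ (f (X ω))) ∂P := by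
      refine integral_congr_ae ?_
      filter_upwards [hf.ae_eq] with ω hω
      rw [hω]
    simp only [mul_sub, mul_one]
    rw [e1, integral_sub hpi (hfX.integrable_fun_mul hφfX), hibp, integral_sub hpi hpΓ]
    ring
  have hbound : |∫ ω, (p (F ω) - F ω * φ (F ω)) ∂P| ≤
      B * ∫ ω, |1 - Γ ω| ∂P + (1 / 2) * ∑' k, ∫ ω, |incr X X' g k ω| * |R k ω| ∂P := by
    rw [hid]
    refine (abs_sub _ _).trans (add_le_add ?_ ?_)
    · rw [← integral_const_mul, ← Real.norm_eq_abs]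
      refine norm_integral_le_of_norm_le (hΓ1.abs.const_mul B) (ae_of_all _ fun ω => ?_)
      rw [norm_mul]
      exact mul_le_mul_of_nonneg_right (hpB _) (abs_nonneg _)
    · rw [abs_mul, abs_of_nonneg (by norm_num : (0 : ℝ) ≤ 1 / 2)]
      refine mul_le_mul_of_nonneg_left ?_ (by norm_num)
      rw [← Real.norm_eq_abs]
      exact tsum_of_norm_bounded hRs.hasSum hgRabs
  refine (ENNReal.ofReal_le_ofReal hbound).trans (ENNReal.ofReal_add_le.trans (le_of_eq ?_))
  rw [ENNReal.ofReal_mul hB, ENNReal.ofReal_mul (by norm_num),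
    ofReal_integral_eq_lintegral_ofReal hΓ1.abs (ae_of_all _ fun ω => abs_nonneg _),
    ENNReal.ofReal_tsum_of_nonneg
      (fun k => integral_nonneg fun ω => mul_nonneg (abs_nonneg _) (abs_nonneg _)) hRs]
  congr 2
  · simp
  · refine tsum_congr fun k => ?_
    refine ofReal_integral_eq_lintegral_ofReal ?_
      (ae_of_all _ fun ω => mul_nonneg (abs_nonneg _) (abs_nonneg _))
    refine (hgR k).abs.congr (ae_of_all _ fun ω => ?_)
    simp only [abs_mul, abs_neg]

end Increments

section Bounds

variable {Ω : Type*} [m0 : MeasurableSpace Ω] {E : ℕ → Type*} [∀ n, MeasurableSpace (E n)]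
  {X X' : Ω → ∀ n, E n} {P : Measure Ω}
  {μ : ∀ n, Measure (E n)} [∀ n, IsProbabilityMeasure (μ n)]

lemma abs_sub_le_mul_of_hasDerivAt {φ p : ℝ → ℝ} {C : ℝ} (hφ : ∀ x, HasDerivAt φ (p x) x)
    (hp : ∀ x, |p x| ≤ C) (x y : ℝ) : |φ x - φ y| ≤ C * |x - y| := by
  have := Convex.norm_image_sub_le_of_norm_hasDerivWithin_le (f := φ) (f' := p) (C := C)
    (s := Set.univ) (x := y) (y := x) (fun z _ => (hφ z).hasDerivWithinAt) (fun z _ => hp z)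
    convex_univ (Set.mem_univ _) (Set.mem_univ _)
  simpa only [Real.norm_eq_abs] using this

lemma continuous_of_abs_sub_le {p : ℝ → ℝ} {C : ℝ} (hC : 0 ≤ C)
    (hp : ∀ x y, |p y - p x| ≤ C * |y - x|) : Continuous p :=
  (LipschitzWith.of_dist_le_mul (K := ⟨C, hC⟩) fun x y => by
    rw [Real.dist_eq, Real.dist_eq]; exact hp y x).continuous

/-- By exchangeability of `X` and `X^{(k)}`, the mean of an antisymmetric increment times the
increment of `ζ(f)` is `-2` times its mean against `ζ(f(X))`. -/
lemma integral_abs_incr_mul_incr_mul_sub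
    (h : MeasurePreserving (fun ω => (X ω, X' ω)) P
      ((Measure.infinitePi μ).prod (Measure.infinitePi μ))) {f g : (∀ n, E n) → ℝ}
    (hfm : Measurable f) (hgm : Measurable g)
    (hf : MemLp f 2 (Measure.infinitePi μ)) (hg : MemLp g 2 (Measure.infinitePi μ))
    {ζ : ℝ → ℝ} (hζ : Measurable ζ) (hζ1 : ∀ x, |ζ x| ≤ 1) (k : ℕ) :
    ∫ ω, |incr X X' g k ω| * (incr X X' f k ω * (ζ (f (resample X X' k ω)) - ζ (f (X ω)))) ∂P
      = -2 * ∫ ω, ζ (f (X ω)) * (|incr X X' g k ω| * incr X X' f k ω) ∂P := by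
  have hX := (measurePreserving_left h).measurable
  have hXk := (measurePreserving_resample h k).measurable
  have i : Integrable (fun ω => |incr X X' g k ω| * incr X X' f k ω) P :=
    (memLp_incr h hg k).norm.integrable_fun_mul (memLp_incr h hf k)
  have i1 : Integrable (fun ω => ζ (f (X ω)) * (|incr X X' g k ω| * incr X X' f k ω)) P :=
    i.bdd_mul (hζ.comp (hfm.comp hX)).aestronglyMeasurable (ae_of_all _ fun ω => hζ1 _)
  have i2 : Integrable
      (fun ω => ζ (f (resample X X' k ω)) * (|incr X X' g k ω| * incr X X' f k ω)) P :=
    i.bdd_mul (hζ.comp (hfm.comp hXk)).aestronglyMeasurable (ae_of_all _ fun ω => hζ1 _)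
  have hs := integral_resample_swap h k
    (Ψ := fun q => ζ (f q.1) * (|g q.2 - g q.1| * (f q.2 - f q.1))) (by fun_prop)
  have hs' : ∫ ω, ζ (f (resample X X' k ω)) * (|incr X X' g k ω| * incr X X' f k ω) ∂P
      = -∫ ω, ζ (f (X ω)) * (|incr X X' g k ω| * incr X X' f k ω) ∂P := by
    simp only [incr]
    rw [hs, ← integral_neg]
    refine integral_congr_ae (ae_of_all _ fun ω => ?_)
    simp only
    rw [abs_sub_comm (g (X ω))]
    ring
  have e : ∀ ω, |incr X X' g k ω| *
      (incr X X' f k ω * (ζ (f (resample X X' k ω)) - ζ (f (X ω))))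
      = ζ (f (resample X X' k ω)) * (|incr X X' g k ω| * incr X X' f k ω)
        - ζ (f (X ω)) * (|incr X X' g k ω| * incr X X' f k ω) := fun ω => by ring
  simp only [e]
  rw [integral_sub i2 i1, hs']
  ring

variable [IsProbabilityMeasure P]

/-- The second-order bound in the Wasserstein distance. -/
theorem wassersteinDist_gaussian_le
    (h : MeasurePreserving (fun ω => (X ω, X' ω)) P
      ((Measure.infinitePi μ).prod (Measure.infinitePi μ))) {F G : Ω → ℝ} {V : ℕ → Ω → ℝ}
    (hF : IsMalliavinDeriv P X F V) (hG : IsOUGenerator P X G F) {f g : (∀ n, E n) → ℝ}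
    (hf : IsRepresentative P X (Measure.infinitePi μ) F f)
    (hg : IsRepresentative P X (Measure.infinitePi μ) G g) :
    wassersteinDist (P.map F) (gaussianReal 0 1) ≤
      ENNReal.ofReal (Real.sqrt (2 / Real.pi)) *
          ∫⁻ ω, ENNReal.ofReal |1 - carreDuChamp P X X' f (fun x => - g x) ω| ∂P
        + (1 / 2) * ∑' k, ∫⁻ ω, ENNReal.ofReal
            (|incr X X' g k ω| * incr X X' f k ω ^ 2) ∂P := by
  refine iSup₂_le fun u hu => ?_
  obtain ⟨φ, p, hφ, hstein, hpB, hpL⟩ := exists_stein_solution_of_lipschitz hu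
  have hφc : Continuous φ := continuous_iff_continuousAt.2 fun x => (hφ x).continuousAt
  have hpc : Continuous p := continuous_of_abs_sub_le (by norm_num) hpL
  have hFm : AEMeasurable F P := hF.memL2X.memLp.1.aemeasurable
  have hui : Integrable (fun ω => u (F ω)) P :=
    (memLp_comp_of_abs_sub_le hF.memL2X.memLp (C := 1) (fun x y => by
      simpa [Real.dist_eq] using hu.dist_le_mul x y) hu.continuous).integrable one_le_two
  have e : ∫ x, u x ∂(P.map F) - ∫ x, u x ∂(gaussianReal 0 1)
      = ∫ ω, (p (F ω) - F ω * φ (F ω)) ∂P := by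
    rw [integral_map hFm hu.continuous.aestronglyMeasurable]
    simp only [hstein, add_sub_cancel_left]
    rw [integral_sub hui (integrable_const _)]
    simp
  rw [e]
  refine (abs_integral_stein_le h hF hG hf hg (abs_sub_le_mul_of_hasDerivAt hφ hpB) hφc
    hpc.measurable hpB).trans ?_
  gcongr with k ω
  exact abs_sub_sub_mul_le_sq hφ hpL _ _

lemma ofReal_abs_integral_mul_le_condExp {m : MeasurableSpace Ω} (hm : m ≤ m0) {Z Y : Ω → ℝ}
    (hZ : Measurable[m] Z) (hZ1 : ∀ ω, |Z ω| ≤ 1) (hY : Integrable Y P) :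
    ENNReal.ofReal |∫ ω, Z ω * Y ω ∂P| ≤ ∫⁻ ω, ENNReal.ofReal |(P[Y | m]) ω| ∂P := by
  have hZm : Measurable[m0] Z := hZ.mono hm le_rfl
  have hZb : ∀ᵐ ω ∂P, ‖Z ω‖ ≤ 1 := ae_of_all _ hZ1
  have hZY : Integrable (fun ω => Z ω * Y ω) P := hY.bdd_mul hZm.aestronglyMeasurable hZb
  have h1 := condExp_mul_of_stronglyMeasurable_left hZ.stronglyMeasurable hZY hY
  have h2 : ∫ ω, Z ω * Y ω ∂P = ∫ ω, Z ω * (P[Y | m]) ω ∂P :=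
    (integral_condExp (μ := P) hm (f := fun ω => Z ω * Y ω)).symm.trans (integral_congr_ae h1)
  have hi : Integrable (P[Y | m]) P := integrable_condExp
  rw [h2, ← ofReal_integral_eq_lintegral_ofReal hi.abs (ae_of_all _ fun ω => abs_nonneg _)]
  refine ENNReal.ofReal_le_ofReal ?_
  rw [← Real.norm_eq_abs]
  refine norm_integral_le_of_norm_le hi.abs (ae_of_all _ fun ω => ?_)
  rw [norm_mul]
  exact mul_le_of_le_one_left (abs_nonneg _) (hZ1 ω)

/-- The remainder of the Stein bound in the Kolmogorov distance. -/
lemma tsum_lintegral_remainder_le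
    (h : MeasurePreserving (fun ω => (X ω, X' ω)) P
      ((Measure.infinitePi μ).prod (Measure.infinitePi μ))) {F : Ω → ℝ} (hFm : Measurable F)
    {f g : (∀ n, E n) → ℝ}
    (hf : IsRepresentative P X (Measure.infinitePi μ) F f)
    (hgm : Measurable g) (hg : MemLp g 2 (Measure.infinitePi μ))
    (hfg : Summable fun k => ∫ ω, |incr X X' g k ω| * |incr X X' f k ω| ∂P)
    {ζ : ℝ → ℝ} (hζ : Monotone ζ) (hζ1 : ∀ x, |ζ x| ≤ 1) :
    (1 / 2) * ∑' k, ∫⁻ ω, ENNReal.ofReal (|incr X X' g k ω| *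
        (incr X X' f k ω * (ζ (f (resample X X' k ω)) - ζ (f (X ω))))) ∂P
      ≤ ∫⁻ ω, ENNReal.ofReal |(P[fun ω' => ∑' k, |incr X X' g k ω'| * incr X X' f k ω'
          | MeasurableSpace.comap F inferInstance]) ω| ∂P := by
  have hX := (measurePreserving_left h).measurable
  have hζm := hζ.measurable
  set Y : ℕ → Ω → ℝ := fun k ω => |incr X X' g k ω| * incr X X' f k ω with hY
  have hYi : ∀ k, Integrable (Y k) P := fun k =>
    (memLp_incr h hg k).norm.integrable_fun_mul (memLp_incr h hf.memLp k)
  have hYabs : ∀ k, ∫ ω, |Y k ω| ∂P = ∫ ω, |incr X X' g k ω| * |incr X X' f k ω| ∂P := fun k => by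
    simp only [hY, abs_mul, abs_abs]
  have hYs : Summable fun k => ∫ ω, |Y k ω| ∂P := by simpa only [hYabs] using hfg
  obtain ⟨hYae, hYsum⟩ := ae_summable_and_integrable_tsum hYi hYs
  have hζi : ∀ k, Integrable (fun ω => ζ (f (X ω)) * Y k ω) P := fun k =>
    (hYi k).bdd_mul (hζm.comp (hf.measurable.comp hX)).aestronglyMeasurable
      (ae_of_all _ fun ω => hζ1 _)
  have hζs : Summable fun k => ∫ ω, ‖ζ (f (X ω)) * Y k ω‖ ∂P := by
    refine Summable.of_nonneg_of_le (fun k => integral_nonneg fun ω => norm_nonneg _)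
      (fun k => ?_) hYs
    refine integral_mono_of_nonneg (ae_of_all _ fun ω => norm_nonneg _) (hYi k).abs
      (ae_of_all _ fun ω => ?_)
    simp only [norm_mul, Real.norm_eq_abs]
    exact mul_le_of_le_one_left (abs_nonneg _) (hζ1 _)
  have htot := (hasSum_integral_of_summable_integral_norm hζi hζs)
  have hζY : ∫ ω, ∑' k, ζ (f (X ω)) * Y k ω ∂P = ∫ ω, ζ (F ω) * ∑' k, Y k ω ∂P := by
    refine integral_congr_ae ?_
    filter_upwards [hf.ae_eq] with ω hω
    rw [hω, tsum_mul_left]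
  have hnn : ∀ k ω, 0 ≤ |incr X X' g k ω| *
      (incr X X' f k ω * (ζ (f (resample X X' k ω)) - ζ (f (X ω)))) := fun k ω => by
    refine mul_nonneg (abs_nonneg _) ?_
    rcases le_total (f (X ω)) (f (resample X X' k ω)) with hle | hle
    · exact mul_nonneg (sub_nonneg.2 hle) (sub_nonneg.2 (hζ hle))
    · exact mul_nonneg_of_nonpos_of_nonpos (sub_nonpos.2 hle) (sub_nonpos.2 (hζ hle))
  have hint : ∀ k, Integrable (fun ω => |incr X X' g k ω| *
      (incr X X' f k ω * (ζ (f (resample X X' k ω)) - ζ (f (X ω))))) P := fun k => by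
    have hXk := (measurePreserving_resample h k).measurable
    have hm : Measurable fun ω => ζ (f (resample X X' k ω)) - ζ (f (X ω)) :=
      (hζm.comp (hf.measurable.comp hXk)).sub (hζm.comp (hf.measurable.comp hX))
    refine ((hYi k).bdd_mul (c := 2) hm.aestronglyMeasurable (ae_of_all _ fun ω => ?_)).congr
      (ae_of_all _ fun ω => ?_)
    · rw [Real.norm_eq_abs]
      refine (abs_sub _ _).trans ?_
      linarith [hζ1 (f (resample X X' k ω)), hζ1 (f (X ω))]
    · simp only [hY]; ring
  have e : ∀ k, ∫⁻ ω, ENNReal.ofReal (|incr X X' g k ω| *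
        (incr X X' f k ω * (ζ (f (resample X X' k ω)) - ζ (f (X ω))))) ∂P
      = ENNReal.ofReal (-2 * ∫ ω, ζ (f (X ω)) * Y k ω ∂P) := fun k => by
    rw [← ofReal_integral_eq_lintegral_ofReal (hint k) (ae_of_all _ (hnn k)),
      integral_abs_incr_mul_incr_mul_sub h hf.measurable hgm hf.memLp hg hζm hζ1 k]
  have hnn' : ∀ k, 0 ≤ -2 * ∫ ω, ζ (f (X ω)) * Y k ω ∂P := fun k => by
    rw [← integral_abs_incr_mul_incr_mul_sub h hf.measurable hgm hf.memLp hg hζm hζ1 k]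
    exact integral_nonneg (hnn k)
  simp only [e]
  rw [← ENNReal.ofReal_tsum_of_nonneg hnn' (htot.summable.mul_left _), tsum_mul_left,
    htot.tsum_eq, hζY]
  have hhalf : (1 / 2 : ℝ≥0∞) = ENNReal.ofReal (1 / 2) := by simp
  rw [hhalf, ← ENNReal.ofReal_mul (by norm_num)]
  refine le_trans (ENNReal.ofReal_le_ofReal ?_) (ofReal_abs_integral_mul_le_condExp
    (Z := fun ω => ζ (F ω)) hFm.comap_le (hζm.comp (comap_measurable F)) (fun ω => hζ1 _) hYsum)
  rw [show ∀ x : ℝ, 1 / 2 * (-2 * x) = -x by intro x; ring]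
  exact neg_le_abs _

/-- The carré-du-champ bound in the Kolmogorov distance. -/
theorem kolmogorovDist_gaussian_le
    (h : MeasurePreserving (fun ω => (X ω, X' ω)) P
      ((Measure.infinitePi μ).prod (Measure.infinitePi μ))) {F G : Ω → ℝ} {V : ℕ → Ω → ℝ}
    (hF : IsMalliavinDeriv P X F V) (hG : IsOUGenerator P X G F) {f g : (∀ n, E n) → ℝ}
    (hf : IsRepresentative P X (Measure.infinitePi μ) F f)
    (hg : IsRepresentative P X (Measure.infinitePi μ) G g) :
    kolmogorovDist (P.map F) (gaussianReal 0 1) ≤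
      ∫⁻ ω, ENNReal.ofReal |1 - carreDuChamp P X X' f (fun x => - g x) ω| ∂P
        + ∫⁻ ω, ENNReal.ofReal |(P[fun ω' => ∑' k, |incr X X' g k ω'| * incr X X' f k ω'
            | MeasurableSpace.comap F inferInstance]) ω| ∂P := by
  refine iSup_le fun z => ?_
  obtain ⟨φ, p, ζ, hφc, hpm, hζ, hζ1, hp1, hstein, hrem⟩ := exists_stein_solution_indicator z
  have hX := (measurePreserving_left h).measurable
  have hFm : Measurable F := hF.memL2X.measurable.mono (sigmaCoord_le hX _) le_rfl
  have hφL : ∀ x y, |φ x - φ y| ≤ 3 * |x - y| := fun x y => by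
    have h1 : (x - y) * (ζ x - ζ y) ≤ 2 * |x - y| := by
      refine (le_abs_self _).trans ?_
      rw [abs_mul, mul_comm]
      refine mul_le_mul_of_nonneg_right ?_ (abs_nonneg _)
      refine (abs_sub _ _).trans ?_
      linarith [hζ1 x, hζ1 y]
    have h2 : |p y * (x - y)| ≤ |x - y| := by
      rw [abs_mul]; exact mul_le_of_le_one_left (abs_nonneg _) (hp1 y)
    have h3 := abs_add_le (φ x - φ y - p y * (x - y)) (p y * (x - y))
    rw [sub_add_cancel] at h3
    linarith [hrem y x]
  have e : (P.map F).real (Set.Iic z) - (gaussianReal 0 1).real (Set.Iic z)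
      = ∫ ω, (p (F ω) - F ω * φ (F ω)) ∂P := by
    simp only [hstein, add_sub_cancel_left]
    have hi : Integrable (fun ω => (Set.Iic z).indicator (1 : ℝ → ℝ) (F ω)) P := by
      have : (fun ω => (Set.Iic z).indicator (1 : ℝ → ℝ) (F ω))
          = (F ⁻¹' Set.Iic z).indicator 1 := rfl
      rw [this]
      exact (integrable_const (1 : ℝ)).indicator (hFm measurableSet_Iic)
    rw [integral_sub hi (integrable_const _), map_measureReal_apply hFm measurableSet_Iic]
    have : (fun ω => (Set.Iic z).indicator (1 : ℝ → ℝ) (F ω))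
          = (F ⁻¹' Set.Iic z).indicator 1 := rfl
    rw [this, integral_indicator_one (hFm measurableSet_Iic)]
    simp [stdCdf]
  rw [e]
  obtain ⟨U, hU, -⟩ := id hG
  have hfg := summable_integral_abs_mul_incr h hf.memLp hg.memLp
    (hF.summable_integral_incr_sq h hf) (hU.summable_integral_incr_sq h hg)
  refine (abs_integral_stein_le h hF hG hf hg hφL hφc hpm hp1).trans ?_
  rw [ENNReal.ofReal_one, one_mul]
  refine add_le_add le_rfl (le_trans ?_ (tsum_lintegral_remainder_le h hFm hf hg.measurable
    hg.memLp hfg hζ hζ1))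
  gcongr with k ω
  exact hrem _ _

end Bounds

theorem theorem3p8
    {E : ℕ → Type*} [∀ n, MeasurableSpace (E n)]
    (μ : ∀ n, Measure (E n)) [∀ n, IsProbabilityMeasure (μ n)]
    {Ω : Type*} [MeasurableSpace Ω] (P : Measure Ω) [IsProbabilityMeasure P]
    (X X' : Ω → ∀ n, E n) (hX : Measurable X) (hX' : Measurable X')
    (hXlaw : P.map X = Measure.infinitePi μ) (hX'law : P.map X' = Measure.infinitePi μ)
    (hindep : IndepFun X X' P)
    (F : Ω → ℝ) (hF : MemDomD P X F) (hF0 : ∫ ω, F ω ∂P = 0)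
    (f g : (∀ n, E n) → ℝ)
    (hf : IsRepresentative P X (Measure.infinitePi μ) F f)
    (hg : IsRepresentative P X (Measure.infinitePi μ) (ouPseudoInverse P X F) g) :
    -- the series defining `Γ₀(F, -L⁻¹F)` converges almost surely, to an integrable limit
    (∀ᵐ ω ∂P, Summable fun k => carreDuChampTerm P X X' f (fun x => - g x) k ω) ∧
    Integrable (carreDuChamp P X X' f (fun x => - g x)) P ∧
    -- so does the series in the Kolmogorov bound
    (∀ᵐ ω ∂P, Summable fun k =>
      |g (resample X X' k ω) - g (X ω)| * (f (resample X X' k ω) - f (X ω))) ∧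
    Integrable (fun ω => ∑' k,
      |g (resample X X' k ω) - g (X ω)| * (f (resample X X' k ω) - f (X ω))) P ∧
    -- the Wasserstein bound
    wassersteinDist (P.map F) (gaussianReal 0 1) ≤
      ENNReal.ofReal (Real.sqrt (2 / Real.pi)) *
          ∫⁻ ω, ENNReal.ofReal |1 - carreDuChamp P X X' f (fun x => - g x) ω| ∂P
        + (1 / 2) * ∑' k, ∫⁻ ω, ENNReal.ofReal
            (|g (resample X X' k ω) - g (X ω)| *
              (f (resample X X' k ω) - f (X ω)) ^ 2) ∂P ∧
    -- the Kolmogorov bound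
    kolmogorovDist (P.map F) (gaussianReal 0 1) ≤
      ∫⁻ ω, ENNReal.ofReal |1 - carreDuChamp P X X' f (fun x => - g x) ω| ∂P
        + ∫⁻ ω, ENNReal.ofReal
            |(P[fun ω' => ∑' k, |g (resample X X' k ω') - g (X ω')| *
                (f (resample X X' k ω') - f (X ω'))
              | MeasurableSpace.comap F inferInstance]) ω| ∂P := by
  have h : MeasurePreserving (fun ω => (X ω, X' ω)) P
      ((Measure.infinitePi μ).prod (Measure.infinitePi μ)) :=
    ⟨hX.prodMk hX', by
      rw [(indepFun_iff_map_prod_eq_prod_map_map hX.aemeasurable hX'.aemeasurable).1 hindep,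
        hXlaw, hX'law]⟩
  obtain ⟨V, hV⟩ := hF
  have hex := exists_isOUPreimage h hV.memL2X hF0
  have hG : IsOUGenerator P X (ouPseudoInverse P X F) F := by
    rw [ouPseudoInverse, dif_pos hex]
    exact hex.choose_spec.1
  obtain ⟨U, hU, -⟩ := id hG
  have hfs := hV.summable_integral_incr_sq h hf
  have hgs := hU.summable_integral_incr_sq h hg
  have hgs' : Summable fun k => ∫ ω, incr X X' (fun x => - g x) k ω ^ 2 ∂P := by
    refine hgs.congr fun k => integral_congr_ae (ae_of_all _ fun ω => ?_)
    simp only [incr]; ring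
  obtain ⟨hΓ, hΓi⟩ := ae_summable_and_integrable_tsum (fun k => integrable_condExp)
    (summable_integral_abs_carreDuChampTerm h hf.memLp hg.memLp.neg hfs hgs')
  have hYs : Summable fun k => ∫ ω, |(|incr X X' g k ω| * incr X X' f k ω)| ∂P := by
    simpa only [abs_mul, abs_abs] using summable_integral_abs_mul_incr h hf.memLp hg.memLp hfs hgs
  obtain ⟨hY, hYi⟩ := ae_summable_and_integrable_tsum (fun k =>
    (memLp_incr h hg.memLp k).norm.integrable_fun_mul (memLp_incr h hf.memLp k)) hYs
  exact ⟨hΓ, hΓi.const_mul _, hY, hYi, wassersteinDist_gaussian_le h hV hG hf hg,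
    kolmogorovDist_gaussian_le h hV hG hf hg⟩
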